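/- There is an absolute constant $C>0$ such that the following holds. Let $\kappa\le -1$ and let $$\alpha\;\ge\; \frac{C\,e^{\kappa^2/2}\,\max\{1,\log^2|\kappa|\}}{|\kappa|}.$$ For each $N$ let $G=G_N$ be an $M_N\times N$ matrix with i.i.d. standard Gaussian entries and rows $g_1,\dots,g_{M_N}$, where $M_N/N\to\alpha$ as $N\to\infty$. Call $\sigma\in\{-1,1\}^N$ a solution of the Ising perceptron with $I=[\kappa,\infty)$ if $\langle g_i,\sigma\rangle/\sqrt N\ge\kappa$ for all $1\le i\le M_N$. Let $D_N$ be non-negative integers with $D_N=o(N/\log N)$. For each $N$ let $\omega$ be a random variable, independent of $G_N$, with values in a probability space $\Omega_N$, and let $\mathcal A_N^\circ:\mathbb R^{M_N\times N}\times\Omega_N\to\mathbb R^N$ be a measurable map such that, for each fixed $\omega$, each of the $N$ coordinates of $\mathcal A_N^\circ(\cdot,\omega)$ is a polynomial of degree at most $D_N$ in the entries of the matrix. Suppose that for some constant $B$ independent of $N$ we have $\mathbb E\big[\|\mathcal A_N^\circ(G_N,\omega)\|^2\big]\le BN$ for all large $N$, where $\|\cdot\|$ is the Euclidean norm. Let $\vec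 U=(U_1,\dots,U_N)$ be i.i.d. uniform on $[-1,1]$, independent of $(G_N,\omega)$, and let $\mathcal A_N(G_N,\omega,\vec U)\in\{-1,1\}^N$ be the vector whose $j$-th coordinate is $1$ if $\big(\mathcal A_N^\circ(G_N,\omega)\big)_j\ge U_j$ and $-1$ otherwise. Then $$\mathbb P\big[\mathcal A_N(G_N,\omega,\vec U)\text{ is a solution of the Ising perceptron with } I=[\kappa,\infty)\big]\longrightarrow 0\qquad (N\to\infty).$$ -/

import Mathlib

open MeasureTheory ProbabilityTheory Filter Topology Asymptotics

noncomputable section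

namespace IsingPerceptron

/-- The discrete cube `{-1, 1}^N`. -/
def cube (N : ℕ) : Set (Fin N → ℝ) := {σ | ∀ j, σ j = 1 ∨ σ j = -1}

/-- The law of an `M × N` disorder matrix whose rows are i.i.d. `N(0, I_N)` vectors,
i.e. whose entries are i.i.d. standard Gaussians. -/
def disorderLaw (M N : ℕ) : Measure (Fin M → Fin N → ℝ) :=
  Measure.pi fun _ => Measure.pi fun _ => gaussianReal 0 1

/-- The solutions of the Ising perceptron with disorder `G` and constraint set `I`: the points
`σ ∈ {-1, 1}^N` with `⟨g_i, σ⟩ / √N ∈ I` for every row `g_i` of `G`. -/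
def solutions {M N : ℕ} (G : Fin M → Fin N → ℝ) (I : Set ℝ) : Set (Fin N → ℝ) :=
  {σ | σ ∈ cube N ∧ ∀ i, (∑ j, G i j * σ j) / Real.sqrt N ∈ I}

/-- The law of `N` i.i.d. uniform random variables on `[-1, 1]`. -/
def roundingLaw (N : ℕ) : Measure (Fin N → ℝ) :=
  Measure.pi fun _ => cond volume (Set.Icc (-1 : ℝ) 1)

open Classical in
/-- Coordinatewise rounding of `x` to the cube with thresholds `U`. -/
def round {N : ℕ} (U x : Fin N → ℝ) : Fin N → ℝ := fun j => if U j ≤ x j then 1 else -1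

/-- For each fixed value of the auxiliary randomness `ω`, every output coordinate of `A` is a real
polynomial of total degree at most `D` in the entries of the disorder matrix. -/
def IsPolynomialOfDegree {M N : ℕ} {Ω : Type*} (D : ℕ)
    (A : (Fin M → Fin N → ℝ) → Ω → Fin N → ℝ) : Prop :=
  ∀ ω j, ∃ p : MvPolynomial (Fin M × Fin N) ℝ, p.totalDegree ≤ D ∧
    ∀ G, A G ω j = MvPolynomial.eval (fun e => G e.1 e.2) p

/-- `𝔼 ‖A(G, ω)‖²` (Euclidean norm), with `G` and `ω` independent and `ω ∼ P`. -/
def secondMoment {M N : ℕ} {Ω : Type*} [MeasurableSpace Ω] (P : Measure Ω)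
    (A : (Fin M → Fin N → ℝ) → Ω → Fin N → ℝ) : ENNReal :=
  ∫⁻ z, ENNReal.ofReal (∑ j, A z.1 z.2 j ^ 2) ∂((disorderLaw M N).prod P)

/-- The probability that the randomized rounding of `A` solves the Ising perceptron with constraint
set `I`; the disorder `G`, the auxiliary randomness `ω ∼ P` and the rounding thresholds `U` are
independent. -/
def successProb {M N : ℕ} {Ω : Type*} [MeasurableSpace Ω] (P : Measure Ω)
    (A : (Fin M → Fin N → ℝ) → Ω → Fin N → ℝ) (I : Set ℝ) : ENNReal :=
  ((disorderLaw M N).prod (P.prod (roundingLaw N)))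
    {z | round z.2.2 (A z.1 z.2.1) ∈ solutions z.1 I}

end IsingPerceptron

end

set_option linter.unusedSectionVars false

/-! The obstruction is a multi-overlap gap along a correlated path of disorders. Let `q` be the
Gaussian mass below `κ`, and run a stationary Ornstein-Uhlenbeck chain of disorders with one-step
correlation `ρ = 1 - ε`, where `ε` is a small constant divided by `D + 1`.

Lower bound. A polynomial of degree `D` is stable under one step
(`RotationInvariant.lintegral_sub_sq_le`). So if the algorithm succeeds with probability `p`, then
for a suitable fixed value of `ω` and of the thresholds, both ends of a step are solved, by points
at distance at most `δN`, with probability at least `p²/2` (`exists_stable_of_successProb`). The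
chain is reversible, so by a Jensen argument this happens at all of `T = O(D)` consecutive steps
with probability at least `(p²/2)^T`, which is `exp(-o(N))` (`RotationInvariant.pow_le_pathLaw`).

Upper bound. A slowly moving sequence of outputs contains `n + 1` points that are pairwise
separated, once overlaps are discounted by the time decorrelation, while each new point is within
`2δN` of an earlier one (`exists_separated_times`). The closeness makes such tuples few: `2^N` times
`n` factors given by the volume of a small Hamming ball. The separation makes the constraint
violations of one row nearly disjoint, so by Bonferroni a row is satisfied by the whole tuple with
probability at most `1 - (n+1)q/2`. A union bound gives `pathLaw_stablePairs_le`, which contradicts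
the lower bound as soon as `log 2 + n · (ball entropy per coordinate) < α (n+1) q / 2`.

Parameters. With `K = |κ|`, take `n ≈ K²`, `δ` of order `max(1, log K)/K²` and balls of that radius,
whose entropy per coordinate is of order `max(1, log² K)/K²`. Both `log 2` and `n` ball entropies
are then dominated by `n α q`, because `q` is at least of order `exp(-K²/2)/K`. One logarithm comes
from `δ`, the other from the entropy of the ball. -/

noncomputable section

namespace IsingPerceptron

/-! ### Rotation-invariant measures -/

/-- A measure `γ` such that `γ ⊗ γ` is invariant under the reflections
`(x, z) ↦ (c x + s z, s x - c z)`, `c² + s² = 1`, like a centered Gaussian measure. -/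
def RotationInvariant {E : Type*} [AddCommGroup E] [Module ℝ E] [MeasurableSpace E]
    (γ : Measure E) : Prop :=
  ∀ c s : ℝ, c ^ 2 + s ^ 2 = 1 →
    MeasurePreserving (fun p : E × E => (c • p.1 + s • p.2, s • p.1 - c • p.2))
      (γ.prod γ) (γ.prod γ)

/-- One step of the Ornstein-Uhlenbeck chain with correlation `ρ` from `x` with innovation `z`. -/
def ouStep {E : Type*} [AddCommGroup E] [Module ℝ E] (ρ : ℝ) (x z : E) : E :=
  ρ • x + √(1 - ρ ^ 2) • z

/-- The reflection is a planar rotation followed by a sign change of the second coordinate, and both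
preserve a product of standard Gaussians. -/
theorem rotationInvariant_gaussianReal : RotationInvariant (gaussianReal 0 1) := by
  intro c s h
  obtain ⟨θ, hc, hs⟩ : ∃ θ, Real.cos θ = c ∧ Real.sin θ = s := by
    have hn : ‖(⟨c, s⟩ : ℂ)‖ = 1 := by
      rw [Complex.norm_def, Complex.normSq_mk, Real.sqrt_eq_one]; nlinarith
    have h0 : (⟨c, s⟩ : ℂ) ≠ 0 := by
      intro h0; rw [h0] at hn; simp at hn
    refine ⟨Complex.arg ⟨c, s⟩, ?_, ?_⟩
    · rw [Complex.cos_arg h0, hn]; simp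
    · rw [Complex.sin_arg, hn]; simp
  have h1 : MeasurePreserving (ContinuousLinearMap.rotation θ : ℝ × ℝ → ℝ × ℝ)
      ((gaussianReal 0 1).prod (gaussianReal 0 1)) ((gaussianReal 0 1).prod (gaussianReal 0 1)) :=
    ⟨(ContinuousLinearMap.rotation θ).continuous.measurable,
      IsGaussian.map_rotation_eq_self (by simp) θ⟩
  have h2 : MeasurePreserving (fun x : ℝ => -x) (gaussianReal 0 1) (gaussianReal 0 1) :=
    ⟨measurable_neg, by rw [gaussianReal_map_neg]; simp⟩
  have h3 := ((MeasurePreserving.id (gaussianReal 0 1)).prod h2).comp h1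
  convert h3 using 1
  ext p
  · simp [ContinuousLinearMap.rotation_apply, hc, hs]
  · simp [ContinuousLinearMap.rotation_apply, hc, hs]; ring

theorem RotationInvariant.pi {ι E : Type*} [Fintype ι] [AddCommGroup E] [Module ℝ E]
    [MeasurableSpace E] {γ : Measure E} [IsProbabilityMeasure γ] (hγ : RotationInvariant γ) :
    RotationInvariant (Measure.pi fun _ : ι => γ) := by
  intro c s h
  have h1 := measurePreserving_arrowProdEquivProdArrow E E ι (fun _ => γ) (fun _ => γ)
  have h2 := measurePreserving_pi (fun _ : ι => γ.prod γ) (fun _ : ι => γ.prod γ)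
    (fun _ => hγ c s h)
  have h3 := (h1.comp h2).comp (h1.symm _)
  convert h3 using 1
  rfl

theorem rotationInvariant_disorderLaw (M N : ℕ) : RotationInvariant (disorderLaw M N) :=
  rotationInvariant_gaussianReal.pi.pi

instance (M N : ℕ) : IsProbabilityMeasure (disorderLaw M N) := by
  unfold disorderLaw; infer_instance

theorem sq_add_sq_sqrt {ρ : ℝ} (h0 : 0 ≤ ρ) (h1 : ρ ≤ 1) : ρ ^ 2 + √(1 - ρ ^ 2) ^ 2 = 1 := by
  rw [Real.sq_sqrt (by nlinarith)]; ring

/-! ### Reversibility and positivity of the Ornstein-Uhlenbeck operator -/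

section Kernel

variable {E : Type*} [AddCommGroup E] [Module ℝ E] [MeasurableSpace E] [MeasurableAdd₂ E]
  [MeasurableConstSMul ℝ E] {γ : Measure E} [IsProbabilityMeasure γ]

theorem measurable_ouStep (ρ : ℝ) : Measurable fun p : E × E => ouStep ρ p.1 p.2 := by
  unfold ouStep
  exact (measurable_fst.const_smul ρ).add (measurable_snd.const_smul _)

theorem RotationInvariant.measurePreserving_ouStep (hγ : RotationInvariant γ) {ρ : ℝ}
    (h0 : 0 ≤ ρ) (h1 : ρ ≤ 1) :
    MeasurePreserving (fun p : E × E => ouStep ρ p.1 p.2) (γ.prod γ) γ :=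
  measurePreserving_fst.comp (hγ _ _ (sq_add_sq_sqrt h0 h1))

/-- The Ornstein-Uhlenbeck pair is exchangeable. -/
theorem RotationInvariant.lintegral_ouStep_swap (hγ : RotationInvariant γ) {ρ : ℝ}
    (h0 : 0 ≤ ρ) (h1 : ρ ≤ 1) {F : E × E → ENNReal} (hF : Measurable F) :
    ∫⁻ x, ∫⁻ z, F (x, ouStep ρ x z) ∂γ ∂γ = ∫⁻ x, ∫⁻ z, F (ouStep ρ x z, x) ∂γ ∂γ := by
  have hs := sq_add_sq_sqrt h0 h1
  have m1 : Measurable fun p : E × E => F (p.1, ouStep ρ p.1 p.2) :=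
    hF.comp (measurable_fst.prodMk (measurable_ouStep ρ))
  have m2 : Measurable fun p : E × E => F (ouStep ρ p.1 p.2, p.1) :=
    hF.comp ((measurable_ouStep ρ).prodMk measurable_fst)
  rw [← lintegral_prod (fun p : E × E => F (p.1, ouStep ρ p.1 p.2)) m1.aemeasurable,
    ← lintegral_prod (fun p : E × E => F (ouStep ρ p.1 p.2, p.1)) m2.aemeasurable,
    ← (hγ _ _ hs).lintegral_comp m1]
  refine lintegral_congr fun p => ?_
  have : ouStep ρ (ρ • p.1 + √(1 - ρ ^ 2) • p.2) (√(1 - ρ ^ 2) • p.1 - ρ • p.2) = p.1 := by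
    calc _ = (ρ ^ 2 + √(1 - ρ ^ 2) ^ 2) • p.1 := by unfold ouStep; module
      _ = _ := by rw [hs, one_smul]
  simp only [this]
  rfl

/-- The Ornstein-Uhlenbeck transition operator weighted by `k`. -/
def weightedOU (γ : Measure E) (ρ : ℝ) (k : E → E → ENNReal) (f : E → ENNReal) (x : E) : ENNReal :=
  ∫⁻ z, k x (ouStep ρ x z) * f (ouStep ρ x z) ∂γ

theorem measurable_weightedOU {ρ : ℝ} {k : E → E → ENNReal} (hk : Measurable (Function.uncurry k))
    {f : E → ENNReal} (hf : Measurable f) : Measurable (weightedOU γ ρ k f) := by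
  unfold weightedOU
  refine Measurable.lintegral_prod_right'
    (f := fun p : E × E => k p.1 (ouStep ρ p.1 p.2) * f (ouStep ρ p.1 p.2)) ?_
  exact (hk.comp (measurable_fst.prodMk (measurable_ouStep ρ))).mul (hf.comp (measurable_ouStep ρ))

theorem RotationInvariant.lintegral_mul_weightedOU (hγ : RotationInvariant γ) {ρ : ℝ}
    (h0 : 0 ≤ ρ) (h1 : ρ ≤ 1) {k : E → E → ENNReal} (hk : Measurable (Function.uncurry k))
    (hsymm : ∀ x y, k x y = k y x) {f g : E → ENNReal} (hf : Measurable f) (hg : Measurable g) :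
    ∫⁻ x, f x * weightedOU γ ρ k g x ∂γ = ∫⁻ x, weightedOU γ ρ k f x * g x ∂γ := by
  have key := hγ.lintegral_ouStep_swap h0 h1
    (F := fun p => f p.1 * (k p.1 p.2 * g p.2))
    ((hf.comp measurable_fst).mul (hk.mul (hg.comp measurable_snd)))
  have m : ∀ x : E, Measurable fun z => ouStep ρ x z := fun x =>
    (measurable_ouStep ρ).comp (measurable_const.prodMk measurable_id)
  have mk : ∀ x : E, Measurable fun z => k x (ouStep ρ x z) := fun x =>
    hk.comp (measurable_const.prodMk (m x))
  calc _ = ∫⁻ x, ∫⁻ z, f x * (k x (ouStep ρ x z) * g (ouStep ρ x z)) ∂γ ∂γ := by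
        refine lintegral_congr fun x => ?_
        exact (lintegral_const_mul _ ((mk x).mul (hg.comp (m x)))).symm
    _ = _ := key
    _ = _ := by
        refine lintegral_congr fun x => ?_
        refine Eq.trans ?_ (lintegral_mul_const _ ((mk x).mul (hf.comp (m x))))
        refine lintegral_congr fun z => ?_
        simp only [hsymm x]
        ring

theorem sq_lintegral_le {α : Type*} [MeasurableSpace α] {μ : Measure α} [IsProbabilityMeasure μ]
    {f : α → ENNReal} (hf : Measurable f) : (∫⁻ x, f x ∂μ) ^ 2 ≤ ∫⁻ x, f x ^ 2 ∂μ := by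
  have h := ENNReal.lintegral_mul_le_Lp_mul_Lq μ Real.HolderConjugate.two_two hf.aemeasurable
    (g := 1) aemeasurable_const
  simp only [mul_one, Pi.one_apply, ENNReal.one_rpow, lintegral_one, measure_univ] at h
  have h2 := pow_le_pow_left₀ (zero_le) h 2
  rwa [← ENNReal.rpow_natCast (_ ^ _), ← ENNReal.rpow_mul, show (1 / 2 * ((2 : ℕ) : ℝ)) = 1 by norm_num,
    ENNReal.rpow_one, show (fun x => f x ^ (2:ℝ)) = fun x => f x ^ 2 by
      ext x; exact ENNReal.rpow_two _] at h2

/-- The step with correlation `ρ` is the square of the self-adjoint step `Q` with correlation `√ρ`,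
so the right side is the second moment of `Q f`, while `Q f` and `f` have the same mean. -/
theorem RotationInvariant.sq_lintegral_le_ouStep (hγ : RotationInvariant γ) {ρ : ℝ}
    (h0 : 0 ≤ ρ) (h1 : ρ < 1) {f : E → ENNReal} (hf : Measurable f) :
    (∫⁻ x, f x ∂γ) ^ 2 ≤ ∫⁻ x, ∫⁻ z, f x * f (ouStep ρ x z) ∂γ ∂γ := by
  set c := √ρ with hc
  have hc2 : c ^ 2 = ρ := Real.sq_sqrt h0
  have hc0 : 0 ≤ c := Real.sqrt_nonneg _
  have hc1 : c ≤ 1 := Real.sqrt_le_one.mpr h1.le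
  set Q : (E → ENNReal) → E → ENNReal := weightedOU γ c fun _ _ => 1 with hQ
  have hQm : ∀ g : E → ENNReal, Measurable g → Measurable (Q g) := fun g hg =>
    measurable_weightedOU measurable_const hg
  have hsymm : ∀ f g : E → ENNReal, Measurable f → Measurable g →
      ∫⁻ x, f x * Q g x ∂γ = ∫⁻ x, Q f x * g x ∂γ := fun f g hf hg =>
    hγ.lintegral_mul_weightedOU hc0 hc1 measurable_const (fun _ _ => rfl) hf hg
  have m : ∀ r (x : E), Measurable fun z => ouStep r x z := fun r x =>
    (measurable_ouStep r).comp (measurable_const.prodMk measurable_id)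
  have hQQ : ∀ x, Q (Q f) x = ∫⁻ z, f (ouStep ρ x z) ∂γ := by
    intro x
    have hpos : 0 < 1 - ρ ^ 2 := by nlinarith
    set h := √(1 - ρ ^ 2) with hh
    have hh0 : 0 < h := Real.sqrt_pos.mpr hpos
    have hh2 : h ^ 2 = 1 - ρ ^ 2 := Real.sq_sqrt hpos.le
    set s := √(1 - c ^ 2) with hs
    have hs2 : s ^ 2 = 1 - ρ := by rw [hs, Real.sq_sqrt (by rw [hc2]; linarith), hc2]
    -- The two innovations enter as `c s z₁ + s z₂`, of variance `(1 + ρ)(1 - ρ) = h²`; division by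
    -- `h` gives a unit vector of coefficients, which is where `ρ < 1` is needed.
    have hrot := hγ (c * s / h) (s / h) (by
      rw [div_pow, div_pow, mul_pow, hc2, hs2, hh2]; field_simp; ring)
    have hrot' := measurePreserving_fst.comp hrot
    calc Q (Q f) x = ∫⁻ z₁, ∫⁻ z₂, f (c • (c • x + s • z₁) + s • z₂) ∂γ ∂γ := by
          simp only [hQ, weightedOU, one_mul, ouStep, ← hs]
      _ = ∫⁻ z₁, ∫⁻ z₂, f (ouStep ρ x ((c * s / h) • z₁ + (s / h) • z₂)) ∂γ ∂γ := by
          refine lintegral_congr fun z₁ => lintegral_congr fun z₂ => ?_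
          congr 1
          rw [ouStep, ← hh, ← hc2, smul_add, smul_smul, smul_smul, smul_add, smul_smul, smul_smul,
            mul_div_cancel₀ _ hh0.ne', mul_div_cancel₀ _ hh0.ne']
          module
      _ = ∫⁻ p : E × E, f (ouStep ρ x ((c * s / h) • p.1 + (s / h) • p.2)) ∂(γ.prod γ) := by
          rw [lintegral_prod (fun p : E × E => f (ouStep ρ x ((c * s / h) • p.1 + (s / h) • p.2)))]
          exact (hf.comp ((m ρ x).comp hrot'.measurable)).aemeasurable
      _ = ∫⁻ z, f (ouStep ρ x z) ∂γ := hrot'.lintegral_comp (hf.comp (m ρ x))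
  calc (∫⁻ x, f x ∂γ) ^ 2 = (∫⁻ x, Q f x ∂γ) ^ 2 := by
        have := hsymm f 1 hf measurable_const
        have h1 : Q 1 = 1 := by ext x; simp [hQ, weightedOU]
        rw [h1] at this
        simpa using congrArg (· ^ 2) this
    _ ≤ ∫⁻ x, Q f x ^ 2 ∂γ := sq_lintegral_le (hQm f hf)
    _ = ∫⁻ x, f x * Q (Q f) x ∂γ := by
        rw [hsymm f (Q f) hf (hQm f hf)]; simp only [sq]
    _ = _ := by
        refine lintegral_congr fun x => ?_
        rw [hQQ]
        exact (lintegral_const_mul _ (hf.comp (m ρ x))).symm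

end Kernel

/-! ### Noise stability of low-degree polynomials -/

/-- Orthogonal projection in `L²`, with the projection chosen as a genuine function in `V`, since
the Ornstein-Uhlenbeck average is later evaluated pointwise. -/
theorem exists_mem_forall_integral_sub_mul_eq_zero {α : Type*} [MeasurableSpace α] {μ : Measure α}
    (V : Submodule ℝ (α → ℝ)) [FiniteDimensional ℝ V] (hV : ∀ f ∈ V, MemLp f 2 μ)
    {f : α → ℝ} (hf : MemLp f 2 μ) :
    ∃ g ∈ V, ∀ v ∈ V, ∫ x, (f x - g x) * v x ∂μ = 0 := by
  let T : V →ₗ[ℝ] Lp ℝ 2 μ :=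
    { toFun := fun v => (hV v v.2).toLp _
      map_add' := fun u v => MemLp.toLp_add (hV u u.2) (hV v v.2)
      map_smul' := fun c v => MemLp.toLp_const_smul c (hV v v.2) }
  obtain ⟨⟨g, hg⟩, hgT⟩ := (T.range.starProjection_apply_mem (hf.toLp f))
  refine ⟨g, hg, fun v hv => ?_⟩
  have h1 := T.range.starProjection_inner_eq_zero (hf.toLp f) (T ⟨v, hv⟩) ⟨_, rfl⟩
  rw [← hgT] at h1
  have h2 : hf.toLp f - T ⟨g, hg⟩ = (hf.sub (hV g hg)).toLp (f - g) :=
    (MemLp.toLp_sub hf (hV g hg)).symm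
  rw [h2, L2.inner_def] at h1
  rw [← h1]
  refine integral_congr_ae ?_
  filter_upwards [(hf.sub (hV g hg)).coeFn_toLp, (hV v hv).coeFn_toLp] with x h3 h4
  rw [h3, show (T ⟨v, hv⟩ : α → ℝ) x = v x from h4]
  simp [mul_comm]

section Polynomial

variable {E ι : Type*} [AddCommGroup E] [Module ℝ E] [MeasurableSpace E] [MeasurableAdd₂ E]
  [MeasurableConstSMul ℝ E] {γ : Measure E} [IsProbabilityMeasure γ] (L : ι → E →ₗ[ℝ] ℝ)

/-- The polynomials of degree less than `k` in the linear functionals `L i`, as functions. -/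
def degreeBelow (k : ℕ) : Submodule ℝ (E → ℝ) :=
  Submodule.span ℝ {f | ∃ s : Multiset ι, s.card < k ∧ f = fun x => (s.map fun i => L i x).prod}

theorem degreeBelow_mono {k l : ℕ} (h : k ≤ l) : degreeBelow L k ≤ degreeBelow L l := by
  refine Submodule.span_mono ?_
  rintro f ⟨s, hs, rfl⟩
  exact ⟨s, hs.trans_le h, rfl⟩

theorem degreeBelow_zero : degreeBelow L 0 = ⊥ := by
  simp [degreeBelow]

instance [Finite ι] (k : ℕ) : FiniteDimensional ℝ (degreeBelow L k) := by
  refine FiniteDimensional.span_of_finite ℝ ?_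
  refine ((List.finite_length_lt ι k).image fun l x => (l.map fun i => L i x).prod).subset ?_
  rintro f ⟨s, hs, rfl⟩
  induction s using Quotient.inductionOn with
  | h l => exact ⟨l, by simpa using hs, by simp⟩

theorem eval_mem_degreeBelow {D : ℕ} {p : MvPolynomial ι ℝ} (hp : p.totalDegree ≤ D) :
    (fun x => MvPolynomial.eval (fun i => L i x) p) ∈ degreeBelow L (D + 1) := by
  have : (fun x => MvPolynomial.eval (fun i => L i x) p) =
      ∑ d ∈ p.support, p.coeff d • fun x => (d.toMultiset.map fun i => L i x).prod := by
    ext x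
    rw [MvPolynomial.eval_eq, Finset.sum_apply]
    refine Finset.sum_congr rfl fun d _ => ?_
    have h : d.toMultiset.map (fun i => L i x) = (d.mapDomain fun i => L i x).toMultiset :=
      Finsupp.toMultiset_map d _
    simp only [Pi.smul_apply, smul_eq_mul]
    rw [h, Finsupp.prod_toMultiset, Finsupp.prod_mapDomain_index (by simp) (by simp [pow_add])]
    rfl
  rw [this]
  refine Submodule.sum_mem _ fun d hd => Submodule.smul_mem _ _ (Submodule.subset_span ?_)
  refine ⟨_, ?_, rfl⟩
  rw [MvPolynomial.totalDegree_eq] at hp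
  exact Nat.lt_succ_of_le ((Finset.le_sup (f := fun m => (Finsupp.toMultiset m).card) hd).trans hp)

variable {L}

/-- Each further factor of a monomial is absorbed by Hölder at the price of doubling the exponent,
hence the assumption for every finite `p`. -/
theorem memLp_of_mem_degreeBelow (hL : ∀ i (p : ENNReal), p ≠ ⊤ → MemLp (L i) p γ) {k : ℕ}
    {f : E → ℝ} (hf : f ∈ degreeBelow L k) (p : ENNReal) (hp : p ≠ ⊤) : MemLp f p γ := by
  refine Submodule.span_induction ?_ ?_ ?_ ?_ hf
  · rintro _ ⟨s, -, rfl⟩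
    induction s using Multiset.induction_on generalizing p with
    | empty => simpa using memLp_const 1
    | cons a s ih =>
      simp only [Multiset.map_cons, Multiset.prod_cons]
      have h2 : (2 * p) ≠ ⊤ := ENNReal.mul_ne_top (by simp) hp
      have : ENNReal.HolderTriple (2 * p) (2 * p) p := ⟨by
        rw [ENNReal.mul_inv (by simp) (by simp), ← add_mul, ENNReal.inv_two_add_inv_two, one_mul]⟩
      exact (ih (2 * p) h2).mul' (hL a (2 * p) h2)
  · exact MemLp.zero
  · intro f g _ _ h1 h2; exact h1.add h2
  · intro c f _ h1; exact h1.const_smul c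

/-- The Ornstein-Uhlenbeck operator on functions. -/
def ouAverage (γ : Measure E) (ρ : ℝ) (f : E → ℝ) (x : E) : ℝ := ∫ z, f (ouStep ρ x z) ∂γ

/-- Expand each factor as `ρ L(x) + √(1-ρ²) L(z)`: only the term that takes `ρ L(x)` everywhere has
full degree. Integrability is carried along because linearity of the average depends on it. -/
theorem ouAverage_monomial (hL : ∀ i (p : ENNReal), p ≠ ⊤ → MemLp (L i) p γ) (ρ : ℝ)
    (s : Multiset ι) :
    (∀ x, Integrable (fun z => (s.map fun i => L i (ouStep ρ x z)).prod) γ) ∧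
    (ouAverage γ ρ fun x => (s.map fun i => L i x).prod) -
      ρ ^ s.card • (fun x => (s.map fun i => L i x).prod) ∈ degreeBelow L s.card := by
  classical
  induction s using Quotient.inductionOn with
  | h l =>
  set n := l.length with hn
  have hl : (⟦l⟧ : Multiset ι) = (Finset.univ : Finset (Fin n)).val.map l.get := by
    rw [Fin.univ_val_map, List.ofFn_get]; rfl
  have hprod : ∀ x : E, (Multiset.map (fun i => L i x) ⟦l⟧).prod = ∏ i : Fin n, L (l.get i) x := by
    intro x; rw [hl, Multiset.map_map]; rfl
  have hcard : Multiset.card (⟦l⟧ : Multiset ι) = n := rfl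
  have hterm : ∀ t : Finset (Fin n), (fun x => ∏ i ∈ t, L (l.get i) x) ∈
      degreeBelow L (t.card + 1) := fun t => Submodule.subset_span
    ⟨t.val.map l.get, by simp, by ext x; rw [Multiset.map_map]; rfl⟩
  have hexp : ∀ x z, ∏ i : Fin n, L (l.get i) (ouStep ρ x z) =
      ∑ t ∈ Finset.univ.powerset, (∏ i ∈ t, ρ * L (l.get i) x) *
        ∏ i ∈ Finset.univ \ t, √(1 - ρ ^ 2) * L (l.get i) z := by
    intro x z
    rw [← Finset.prod_add]
    simp only [ouStep, map_add, map_smul, smul_eq_mul]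
    rfl
  have hint : ∀ t : Finset (Fin n), ∀ x : E, Integrable (fun z => (∏ i ∈ t, ρ * L (l.get i) x) *
        ∏ i ∈ Finset.univ \ t, √(1 - ρ ^ 2) * L (l.get i) z) γ := by
    intro t x
    simp_rw [Finset.prod_mul_distrib (s := Finset.univ \ t)]
    refine Integrable.const_mul (Integrable.const_mul ?_ _) _
    exact memLp_one_iff_integrable.mp
      (memLp_of_mem_degreeBelow hL (hterm (Finset.univ \ t)) 1 (by simp))
  simp only [hprod, hcard]
  constructor
  · intro x
    simp_rw [hexp]
    exact integrable_finsetSum _ fun t _ => hint t x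
  · have : (ouAverage γ ρ fun x => ∏ i : Fin n, L (l.get i) x) - ρ ^ n • (fun x => ∏ i : Fin n, L (l.get i) x) =
        ∑ t ∈ (Finset.univ.powerset).erase Finset.univ,
          (ρ ^ t.card * ∫ z, ∏ i ∈ Finset.univ \ t, √(1 - ρ ^ 2) * L (l.get i) z ∂γ) •
            fun x => ∏ i ∈ t, L (l.get i) x := by
      ext x
      simp only [Pi.sub_apply, Pi.smul_apply, smul_eq_mul, Finset.sum_apply, ouAverage]
      simp_rw [hexp]
      rw [integral_finsetSum _ fun t _ => hint t x,
        ← Finset.add_sum_erase _ _ (Finset.mem_powerset_self Finset.univ)]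
      simp only [integral_const_mul, Finset.prod_mul_distrib, Finset.prod_const, Finset.card_univ,
        Fintype.card_fin, Finset.sdiff_self, Finset.card_empty, pow_zero, Finset.prod_empty,
        one_mul, integral_const, probReal_univ, smul_eq_mul, mul_one, add_sub_cancel_left]
      exact Finset.sum_congr rfl fun t _ => by ring
    rw [this]
    refine Submodule.sum_mem _ fun t ht => Submodule.smul_mem _ _ ?_
    refine degreeBelow_mono L ?_ (hterm t)
    have := Finset.card_lt_card (Finset.ssubset_univ_iff.mpr (Finset.ne_of_mem_erase ht))
    simpa using this

/-- The operator is triangular for the degree filtration, with diagonal entry `ρ ^ k` in degree `k`.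
This takes the place of a Hermite expansion. -/
theorem ouAverage_mem (hL : ∀ i (p : ENNReal), p ≠ ⊤ → MemLp (L i) p γ) (ρ : ℝ) {k : ℕ}
    {f : E → ℝ} (hf : f ∈ degreeBelow L (k + 1)) :
    (∀ x, Integrable (fun z => f (ouStep ρ x z)) γ) ∧
      ouAverage γ ρ f - ρ ^ k • f ∈ degreeBelow L k := by
  refine Submodule.span_induction ?_ ?_ ?_ ?_ hf
  · rintro _ ⟨s, hs, rfl⟩
    obtain ⟨h1, h2⟩ := ouAverage_monomial hL ρ s
    refine ⟨h1, ?_⟩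
    rcases (Nat.lt_succ_iff.mp hs).eq_or_lt with h | h
    · rw [← h]; exact h2
    · have h3 : (fun x => (s.map fun i => L i x).prod) ∈ degreeBelow L k :=
        Submodule.subset_span ⟨s, h, rfl⟩
      have h4 := Submodule.add_mem _ (degreeBelow_mono L h.le h2)
        (Submodule.smul_mem _ (ρ ^ s.card) h3)
      rw [sub_add_cancel] at h4
      exact Submodule.sub_mem _ h4 (Submodule.smul_mem _ _ h3)
  · refine ⟨fun x => by simp, ?_⟩
    have : ouAverage γ ρ (0 : E → ℝ) = 0 := by ext x; simp [ouAverage]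
    simp [this]
  · rintro f g - - ⟨h1, h2⟩ ⟨h3, h4⟩
    refine ⟨fun x => (h1 x).add (h3 x), ?_⟩
    have : ouAverage γ ρ (f + g) = ouAverage γ ρ f + ouAverage γ ρ g := by
      ext x; exact integral_add (h1 x) (h3 x)
    rw [this, smul_add, add_sub_add_comm]
    exact Submodule.add_mem _ h2 h4
  · rintro c f - ⟨h1, h2⟩
    refine ⟨fun x => (h1 x).const_mul c, ?_⟩
    have : ouAverage γ ρ (c • f) = c • ouAverage γ ρ f := by
      ext x; exact integral_const_mul c _
    rw [this, smul_comm, ← smul_sub]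
    exact Submodule.smul_mem _ _ h2

/-- **Noise stability of polynomials** for rotation invariant measures. -/
theorem RotationInvariant.pow_mul_integral_sq_le (hγ : RotationInvariant γ) [Finite ι]
    (hL : ∀ i (p : ENNReal), p ≠ ⊤ → MemLp (L i) p γ) {ρ : ℝ} (h0 : 0 ≤ ρ) (h1 : ρ ≤ 1) (k : ℕ)
    {f : E → ℝ} (hf : f ∈ degreeBelow L k) :
    ρ ^ k * ∫ x, f x * f x ∂γ ≤ ∫ p, f p.1 * f (ouStep ρ p.1 p.2) ∂(γ.prod γ) := by
  have hV : ∀ {k} {f : E → ℝ}, f ∈ degreeBelow L k → MemLp f 2 γ := fun hf =>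
    memLp_of_mem_degreeBelow hL hf 2 (by simp)
  have hou := hγ.measurePreserving_ouStep h0 h1
  have hI : ∀ {f g : E → ℝ}, MemLp f 2 γ → MemLp g 2 γ →
      Integrable (fun p : E × E => f p.1 * g (ouStep ρ p.1 p.2)) (γ.prod γ) := fun hf hg =>
    (hf.comp_measurePreserving measurePreserving_fst).integrable_mul
      (hg.comp_measurePreserving hou)
  have hJ : ∀ {f g : E → ℝ}, MemLp f 2 γ → MemLp g 2 γ →
      Integrable (fun x => f x * g x) γ := fun hf hg => hf.integrable_mul hg
  have hS : ∀ {f g : E → ℝ}, MemLp f 2 γ → MemLp g 2 γ →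
      ∫ p, f p.1 * g (ouStep ρ p.1 p.2) ∂(γ.prod γ) = ∫ x, f x * ouAverage γ ρ g x ∂γ := by
    intro f g hf hg
    rw [integral_prod _ (hI hf hg)]
    refine integral_congr_ae (Eventually.of_forall fun x => ?_)
    exact integral_const_mul (f x) fun z => g (ouStep ρ x z)
  have hsymm : ∀ {f g : E → ℝ}, MemLp f 2 γ → MemLp g 2 γ →
      ∫ p, f p.1 * g (ouStep ρ p.1 p.2) ∂(γ.prod γ) =
        ∫ p, g p.1 * f (ouStep ρ p.1 p.2) ∂(γ.prod γ) := by
    intro f g hf hg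
    have hs := sq_add_sq_sqrt h0 h1
    have hT := hγ _ _ hs
    have := integral_map (f := fun p : E × E => f p.1 * g (ouStep ρ p.1 p.2)) hT.aemeasurable
      (by rw [hT.map_eq]; exact (hI hf hg).aestronglyMeasurable)
    rw [hT.map_eq] at this
    rw [this]
    refine integral_congr_ae (Eventually.of_forall fun p => ?_)
    have e : ouStep ρ (ρ • p.1 + √(1 - ρ ^ 2) • p.2) (√(1 - ρ ^ 2) • p.1 - ρ • p.2) = p.1 := by
      calc _ = (ρ ^ 2 + √(1 - ρ ^ 2) ^ 2) • p.1 := by unfold ouStep; module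
        _ = _ := by rw [hs, one_smul]
    simp only [e]
    rw [mul_comm]; rfl
  induction k generalizing f with
  | zero =>
    rw [degreeBelow_zero, Submodule.mem_bot] at hf
    simp [hf]
  | succ k ih =>
    -- Split `f = g + h` with `h` orthogonal to all lower degrees. Lower degrees are stable under
    -- the self-adjoint operator, so the cross terms vanish, and on `h` the quadratic form is
    -- exactly `ρ ^ k` times the squared norm.
    obtain ⟨g, hg, hgo⟩ := exists_mem_forall_integral_sub_mul_eq_zero (degreeBelow L k)
      (fun f hf => hV hf) (hV hf)
    set h : E → ℝ := f - g with hh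
    have hhm : h ∈ degreeBelow L (k + 1) :=
      Submodule.sub_mem _ hf (degreeBelow_mono L k.le_succ hg)
    have hfgh : f = g + h := by rw [hh]; abel
    have horth : ∀ v ∈ degreeBelow L k, ∫ x, h x * v x ∂γ = 0 := hgo
    have mg := hV hg
    have mh := hV hhm
    have hPg : ouAverage γ ρ g ∈ degreeBelow L k := by
      have := (ouAverage_mem hL ρ (degreeBelow_mono L k.le_succ hg)).2
      simpa using Submodule.add_mem _ this (Submodule.smul_mem _ (ρ ^ k) hg)
    have hgh : ∫ p, h p.1 * g (ouStep ρ p.1 p.2) ∂(γ.prod γ) = 0 := by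
      rw [hS mh mg]; exact horth _ hPg
    have hhh : ∫ p, h p.1 * h (ouStep ρ p.1 p.2) ∂(γ.prod γ) = ρ ^ k * ∫ x, h x * h x ∂γ := by
      rw [hS mh mh]
      have hv := (ouAverage_mem hL ρ hhm).2
      have := horth _ hv
      have e : ∀ x, h x * ouAverage γ ρ h x =
          h x * (ouAverage γ ρ h - ρ ^ k • h) x + ρ ^ k * (h x * h x) := by
        intro x; simp only [Pi.sub_apply, Pi.smul_apply, smul_eq_mul]; ring
      simp_rw [e]
      rw [integral_add (hJ mh (hV hv)) ((hJ mh mh).const_mul _), this, integral_const_mul, zero_add]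
    have e1 : ∫ x, f x * f x ∂γ = ∫ x, g x * g x ∂γ + ∫ x, h x * h x ∂γ := by
      have e : ∀ x, f x * f x = g x * g x + h x * h x + 2 * (h x * g x) := by
        intro x; rw [hfgh, Pi.add_apply]; ring
      simp_rw [e]
      have i1 : Integrable (fun x => g x * g x + h x * h x) γ := (hJ mg mg).add (hJ mh mh)
      rw [integral_add i1 ((hJ mh mg).const_mul _),
        integral_add (hJ mg mg) (hJ mh mh), integral_const_mul, horth g hg]
      ring
    have e2 : ∫ p, f p.1 * f (ouStep ρ p.1 p.2) ∂(γ.prod γ) =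
        ∫ p, g p.1 * g (ouStep ρ p.1 p.2) ∂(γ.prod γ) + ρ ^ k * ∫ x, h x * h x ∂γ := by
      have e : ∀ p : E × E, f p.1 * f (ouStep ρ p.1 p.2) =
          g p.1 * g (ouStep ρ p.1 p.2) + h p.1 * h (ouStep ρ p.1 p.2) +
            (g p.1 * h (ouStep ρ p.1 p.2) + h p.1 * g (ouStep ρ p.1 p.2)) := by
        intro x; rw [hfgh]; simp only [Pi.add_apply]; ring
      simp_rw [e]
      have i1 : Integrable (fun p : E × E => g p.1 * g (ouStep ρ p.1 p.2) +
        h p.1 * h (ouStep ρ p.1 p.2)) (γ.prod γ) := (hI mg mg).add (hI mh mh)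
      have i2 : Integrable (fun p : E × E => g p.1 * h (ouStep ρ p.1 p.2) +
        h p.1 * g (ouStep ρ p.1 p.2)) (γ.prod γ) := (hI mg mh).add (hI mh mg)
      rw [integral_add i1 i2,
        integral_add (hI mg mg) (hI mh mh), integral_add (hI mg mh) (hI mh mg), hhh, hsymm mg mh,
        hgh]
      ring
    rw [e1, e2]
    have p1 : 0 ≤ ∫ x, g x * g x ∂γ := integral_nonneg fun x => mul_self_nonneg _
    have p2 : 0 ≤ ∫ x, h x * h x ∂γ := integral_nonneg fun x => mul_self_nonneg _
    have hk : ρ ^ (k + 1) ≤ ρ ^ k := pow_le_pow_of_le_one h0 h1 k.le_succ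
    nlinarith [ih hg]

theorem RotationInvariant.lintegral_sub_sq_le (hγ : RotationInvariant γ) [Finite ι]
    (hL : ∀ i (p : ENNReal), p ≠ ⊤ → MemLp (L i) p γ) {ρ : ℝ} (h0 : 0 ≤ ρ) (h1 : ρ ≤ 1) (k : ℕ)
    {f : E → ℝ} (hf : f ∈ degreeBelow L k) :
    ∫⁻ p, ENNReal.ofReal ((f p.1 - f (ouStep ρ p.1 p.2)) ^ 2) ∂(γ.prod γ) ≤
      ENNReal.ofReal (2 * (1 - ρ ^ k)) * ∫⁻ x, ENNReal.ofReal (f x ^ 2) ∂γ := by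
  have m := memLp_of_mem_degreeBelow hL hf 2 (by simp)
  have m1 := m.comp_measurePreserving (measurePreserving_fst (μ := γ) (ν := γ))
  have hou := hγ.measurePreserving_ouStep h0 h1
  have m2 := m.comp_measurePreserving hou
  have i1 := m1.integrable_sq
  have i2 := m2.integrable_sq
  have i12 : Integrable (fun p : E × E => f p.1 * f (ouStep ρ p.1 p.2)) (γ.prod γ) :=
    m1.integrable_mul m2
  have isub : Integrable (fun p : E × E => (f p.1 - f (ouStep ρ p.1 p.2)) ^ 2) (γ.prod γ) :=
    (m1.sub m2).integrable_sq
  rw [← ofReal_integral_eq_lintegral_ofReal m.integrable_sq (ae_of_all _ fun x => sq_nonneg _),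
    ← ofReal_integral_eq_lintegral_ofReal isub
      (ae_of_all _ fun x => sq_nonneg _), ← ENNReal.ofReal_mul (by
        have := pow_le_one₀ (n := k) h0 h1; linarith)]
  refine ENNReal.ofReal_le_ofReal ?_
  have key := hγ.pow_mul_integral_sq_le hL h0 h1 k hf
  have e1 : ∫ p, (f ∘ Prod.fst) p ^ 2 ∂(γ.prod γ) = ∫ x, f x * f x ∂γ := by
    have := integral_map (μ := γ.prod γ) (φ := Prod.fst) (f := fun x => f x * f x)
      measurable_fst.aemeasurable (by
        rw [measurePreserving_fst.map_eq]; exact (m.integrable_mul m).aestronglyMeasurable)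
    rw [measurePreserving_fst.map_eq] at this
    rw [this]; simp [sq]
  have e2 : ∫ p, (f ∘ fun p : E × E => ouStep ρ p.1 p.2) p ^ 2 ∂(γ.prod γ) = ∫ x, f x * f x ∂γ := by
    have := integral_map (f := fun x => f x * f x) hou.aemeasurable (by
        rw [hou.map_eq]; exact (m.integrable_mul m).aestronglyMeasurable)
    rw [hou.map_eq] at this
    rw [this]; simp [sq]
  have e : ∀ p : E × E, (f p.1 - f (ouStep ρ p.1 p.2)) ^ 2 =
      (f ∘ Prod.fst) p ^ 2 + (f ∘ fun p : E × E => ouStep ρ p.1 p.2) p ^ 2 -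
        2 * (f p.1 * f (ouStep ρ p.1 p.2)) := by
    intro p; simp only [Function.comp_apply]; ring
  calc _ = ∫ p : E × E, (f p.1 - f (ouStep ρ p.1 p.2)) ^ 2 ∂(γ.prod γ) := rfl
    _ = 2 * ∫ x, f x * f x ∂γ - 2 * ∫ p, f p.1 * f (ouStep ρ p.1 p.2) ∂(γ.prod γ) := by
        simp_rw [e]
        have i3 : Integrable (fun p : E × E => (f ∘ Prod.fst) p ^ 2 +
          (f ∘ fun p : E × E => ouStep ρ p.1 p.2) p ^ 2) (γ.prod γ) := i1.add i2
        rw [integral_sub i3 (i12.const_mul 2), integral_add i1 i2, e1, e2,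
          integral_const_mul]
        ring
    _ ≤ _ := by
        simp only [sq] at *
        linarith

end Polynomial

/-- The entries of a matrix, as linear functionals. -/
def entry {M N : ℕ} (e : Fin M × Fin N) : (Fin M → Fin N → ℝ) →ₗ[ℝ] ℝ :=
  LinearMap.proj e.2 ∘ₗ LinearMap.proj e.1

theorem memLp_entry {M N : ℕ} (e : Fin M × Fin N) (p : ENNReal) (hp : p ≠ ⊤) :
    MemLp (entry e) p (disorderLaw M N) := by
  have h1 : MeasurePreserving (fun G : Fin M → Fin N → ℝ => G e.1 e.2) (disorderLaw M N)
      (gaussianReal 0 1) :=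
    (measurePreserving_eval (fun _ : Fin N => gaussianReal 0 1) e.2).comp
      (measurePreserving_eval (fun _ : Fin M => Measure.pi fun _ : Fin N => gaussianReal 0 1) e.1)
  exact (memLp_id_gaussianReal' p hp).comp_measurePreserving h1

/-! ### The stationary Ornstein-Uhlenbeck chain -/

section PathLaw

variable {E : Type*} [AddCommGroup E] [Module ℝ E] [MeasurableSpace E]

/-- Extend a path known up to time `T` by one Ornstein-Uhlenbeck step. -/
def pathStep (ρ : ℝ) (T : ℕ) (p : (ℕ → E) × E) : ℕ → E :=
  fun t => if t ≤ T then p.1 t else ouStep ρ (p.1 T) p.2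

/-- The law of the stationary Ornstein-Uhlenbeck chain run up to time `T` (and then frozen). -/
def pathLaw (γ : Measure E) (ρ : ℝ) : ℕ → Measure (ℕ → E)
  | 0 => γ.map fun x _ => x
  | T + 1 => ((pathLaw γ ρ T).prod γ).map (pathStep ρ T)

theorem pathStep_of_le {ρ : ℝ} {T t : ℕ} (h : t ≤ T) (p : (ℕ → E) × E) :
    pathStep ρ T p t = p.1 t := if_pos h

theorem pathStep_succ {ρ : ℝ} {T : ℕ} (p : (ℕ → E) × E) :
    pathStep ρ T p (T + 1) = ouStep ρ (p.1 T) p.2 := if_neg (by omega)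

variable [MeasurableAdd₂ E] [MeasurableConstSMul ℝ E]

theorem measurable_pathStep (ρ : ℝ) (T : ℕ) :
    Measurable (pathStep ρ T : (ℕ → E) × E → ℕ → E) := by
  refine measurable_pi_lambda _ fun t => ?_
  by_cases h : t ≤ T
  · simp only [pathStep_of_le h]
    exact (measurable_pi_apply t).comp measurable_fst
  · simp only [pathStep, if_neg h]
    exact (measurable_ouStep ρ).comp
      (((measurable_pi_apply T).comp measurable_fst).prodMk measurable_snd)

theorem measurable_const_path : Measurable fun (x : E) (_ : ℕ) => x :=
  measurable_pi_lambda _ fun _ => measurable_id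

variable {γ : Measure E} [IsProbabilityMeasure γ]

instance (ρ : ℝ) (T : ℕ) : IsProbabilityMeasure (pathLaw γ ρ T) := by
  induction T with
  | zero => exact Measure.isProbabilityMeasure_map measurable_const_path.aemeasurable
  | succ T ih => exact Measure.isProbabilityMeasure_map (measurable_pathStep ρ T).aemeasurable

theorem measurePreserving_pathStep (ρ : ℝ) (T : ℕ) :
    MeasurePreserving (pathStep ρ T) ((pathLaw γ ρ T).prod γ) (pathLaw γ ρ (T + 1)) :=
  ⟨measurable_pathStep ρ T, rfl⟩

theorem lintegral_pathLaw_succ (ρ : ℝ) (T : ℕ) {F : (ℕ → E) → ENNReal} (hF : Measurable F) :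
    ∫⁻ w, F w ∂(pathLaw γ ρ (T + 1)) =
      ∫⁻ w, ∫⁻ z, F (pathStep ρ T (w, z)) ∂γ ∂(pathLaw γ ρ T) := by
  rw [← (measurePreserving_pathStep ρ T).lintegral_comp hF]
  exact lintegral_prod _ (hF.comp (measurable_pathStep ρ T)).aemeasurable

theorem RotationInvariant.measurePreserving_eval_pathLaw (hγ : RotationInvariant γ) {ρ : ℝ}
    (h0 : 0 ≤ ρ) (h1 : ρ ≤ 1) {t T : ℕ} (h : t ≤ T) :
    MeasurePreserving (fun w : ℕ → E => w t) (pathLaw γ ρ T) γ := by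
  induction T generalizing t with
  | zero =>
    refine ⟨measurable_pi_apply t, ?_⟩
    rw [pathLaw, Measure.map_map (measurable_pi_apply t) measurable_const_path]
    exact Measure.map_id
  | succ T ih =>
    refine ⟨measurable_pi_apply t, ?_⟩
    rw [pathLaw, Measure.map_map (measurable_pi_apply t) (measurable_pathStep ρ T)]
    rcases h.lt_or_eq with h | rfl
    · have h := Nat.lt_succ_iff.mp h
      rw [show (fun w : ℕ → E => w t) ∘ pathStep ρ T = (fun w => w t) ∘ Prod.fst by
        ext p; exact pathStep_of_le h p]
      exact ((ih h).comp measurePreserving_fst).map_eq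
    · rw [show (fun w : ℕ → E => w (T + 1)) ∘ pathStep ρ T =
          (fun p : E × E => ouStep ρ p.1 p.2) ∘ Prod.map (fun w => w T) id by
        ext p; exact pathStep_succ p]
      exact ((hγ.measurePreserving_ouStep h0 h1).comp
        ((ih le_rfl).prod (MeasurePreserving.id γ))).map_eq

theorem measurable_iterate_weightedOU {ρ : ℝ} {k : E → E → ENNReal}
    (hk : Measurable (Function.uncurry k)) (n : ℕ) {f : E → ENNReal} (hf : Measurable f) :
    Measurable ((weightedOU γ ρ k)^[n] f) := by
  induction n generalizing f with
  | zero => exact hf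
  | succ n ih => exact ih (measurable_weightedOU hk hf)

/-- Integrating out the last innovation replaces `f` by its weighted average; path events with a
weight on every step thus become iterates of one operator. -/
theorem lintegral_pathLaw_prod {ρ : ℝ} {k : E → E → ENNReal} (hk : Measurable (Function.uncurry k))
    (T : ℕ) {f : E → ENNReal} (hf : Measurable f) :
    ∫⁻ w, (∏ t ∈ Finset.range T, k (w t) (w (t + 1))) * f (w T) ∂(pathLaw γ ρ T) =
      ∫⁻ x, (weightedOU γ ρ k)^[T] f x ∂γ := by
  have hm : ∀ T, Measurable fun w : ℕ → E => ∏ t ∈ Finset.range T, k (w t) (w (t + 1)) := fun T =>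
    Finset.measurable_prod _ fun t _ => show Measurable fun w : ℕ → E =>
        Function.uncurry k (w t, w (t + 1)) from hk.comp ((measurable_pi_apply t).prodMk (measurable_pi_apply (t + 1)))
  induction T generalizing f with
  | zero =>
    simp only [Finset.range_zero, Finset.prod_empty, one_mul, pathLaw, Function.iterate_zero, id]
    exact lintegral_map (hf.comp (measurable_pi_apply 0)) measurable_const_path
  | succ T ih =>
    have hm' : Measurable fun w : ℕ → E =>
        (∏ t ∈ Finset.range (T + 1), k (w t) (w (t + 1))) * f (w (T + 1)) :=
      (hm (T + 1)).mul (hf.comp (measurable_pi_apply (T + 1)))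
    rw [lintegral_pathLaw_succ ρ T hm', Function.iterate_succ_apply, ← ih (measurable_weightedOU hk hf)]
    refine lintegral_congr fun w => ?_
    have m : Measurable fun z => ouStep ρ (w T) z :=
      (measurable_ouStep ρ).comp (measurable_const.prodMk measurable_id)
    refine Eq.trans ?_ (lintegral_const_mul _
      ((hk.comp (measurable_const.prodMk m)).mul (hf.comp m)))
    refine lintegral_congr fun z => ?_
    rw [Finset.prod_range_succ, pathStep_succ, pathStep_of_le le_rfl, mul_assoc]
    congr 1
    refine Finset.prod_congr rfl fun t ht => ?_
    have := Finset.mem_range.mp ht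
    rw [pathStep_of_le (by omega), pathStep_of_le (by omega)]

theorem RotationInvariant.lintegral_mul_iterate (hγ : RotationInvariant γ) {ρ : ℝ}
    (h0 : 0 ≤ ρ) (h1 : ρ ≤ 1) {k : E → E → ENNReal} (hk : Measurable (Function.uncurry k))
    (hsymm : ∀ x y, k x y = k y x) (n : ℕ) {f g : E → ENNReal} (hf : Measurable f)
    (hg : Measurable g) :
    ∫⁻ x, f x * (weightedOU γ ρ k)^[n] g x ∂γ = ∫⁻ x, (weightedOU γ ρ k)^[n] f x * g x ∂γ := by
  induction n generalizing f g with
  | zero => rfl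
  | succ n ih =>
    rw [Function.iterate_succ_apply, Function.iterate_succ_apply',
      ih hf (measurable_weightedOU hk hg)]
    exact hγ.lintegral_mul_weightedOU h0 h1 hk hsymm (measurable_iterate_weightedOU hk n hf) hg

/-- A path version of Jensen's inequality for reversible chains. -/
theorem RotationInvariant.pow_le_lintegral_iterate (hγ : RotationInvariant γ) {ρ : ℝ}
    (h0 : 0 ≤ ρ) (h1 : ρ ≤ 1) {k : E → E → ENNReal} (hk : Measurable (Function.uncurry k))
    (hsymm : ∀ x y, k x y = k y x) (n : ℕ) :
    (∫⁻ x, weightedOU γ ρ k 1 x ∂γ) ^ (2 ^ n) ≤ ∫⁻ x, (weightedOU γ ρ k)^[2 ^ n] 1 x ∂γ := by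
  induction n with
  | zero => simp
  | succ n ih =>
    have hm := measurable_iterate_weightedOU (γ := γ) (ρ := ρ) hk (2 ^ n)
      (f := 1) measurable_one
    -- For the self-adjoint operator `W`, `⟨1, W^{2m} 1⟩ = ‖W^m 1‖² ≥ ⟨1, W^m 1⟩²`, so each doubling
    -- of the path length at worst squares the bound.
    calc _ = ((∫⁻ x, weightedOU γ ρ k 1 x ∂γ) ^ (2 ^ n)) ^ 2 := by rw [← pow_mul, pow_succ]
      _ ≤ (∫⁻ x, (weightedOU γ ρ k)^[2 ^ n] 1 x ∂γ) ^ 2 := by gcongr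
      _ ≤ ∫⁻ x, (weightedOU γ ρ k)^[2 ^ n] 1 x ^ 2 ∂γ := sq_lintegral_le hm
      _ = ∫⁻ x, (weightedOU γ ρ k)^[2 ^ n] 1 x * (weightedOU γ ρ k)^[2 ^ n] 1 x ∂γ := by
        simp only [sq]
      _ = ∫⁻ x, (1 : E → ENNReal) x * (weightedOU γ ρ k)^[2 ^ n]
          ((weightedOU γ ρ k)^[2 ^ n] 1) x ∂γ :=
        (hγ.lintegral_mul_iterate h0 h1 hk hsymm _ measurable_one hm).symm
      _ = _ := by
        rw [← Function.iterate_add_apply, ← two_mul, pow_succ']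
        simp

theorem RotationInvariant.pow_le_pathLaw (hγ : RotationInvariant γ) {ρ : ℝ}
    (h0 : 0 ≤ ρ) (h1 : ρ ≤ 1) {S : Set (E × E)} (hS : MeasurableSet S)
    (hsymm : ∀ x y, (x, y) ∈ S → (y, x) ∈ S) (n : ℕ) :
    ((γ.prod γ) {p | (p.1, ouStep ρ p.1 p.2) ∈ S}) ^ (2 ^ n) ≤
      pathLaw γ ρ (2 ^ n) {w | ∀ t < 2 ^ n, (w t, w (t + 1)) ∈ S} := by
  classical
  set k : E → E → ENNReal := fun x y => S.indicator 1 (x, y) with hk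
  have hkm : Measurable (Function.uncurry k) := measurable_one.indicator hS
  have hks : ∀ x y, k x y = k y x := fun x y => by
    simp only [hk, Set.indicator_apply]
    by_cases h : (x, y) ∈ S
    · rw [if_pos h, if_pos (hsymm _ _ h)]; rfl
    · rw [if_neg h, if_neg fun h' => h (hsymm _ _ h')]
  have hp : Measurable fun p : E × E => (p.1, ouStep ρ p.1 p.2) :=
    measurable_fst.prodMk (measurable_ouStep ρ)
  have e1 : (γ.prod γ) {p | (p.1, ouStep ρ p.1 p.2) ∈ S} = ∫⁻ x, weightedOU γ ρ k 1 x ∂γ := by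
    rw [show {p : E × E | (p.1, ouStep ρ p.1 p.2) ∈ S} =
      (fun p : E × E => (p.1, ouStep ρ p.1 p.2)) ⁻¹' S from rfl,
      ← lintegral_indicator_one (hp hS), lintegral_prod _
      (measurable_one.indicator (hp hS)).aemeasurable]
    refine lintegral_congr fun x => lintegral_congr fun z => ?_
    simp only [hk, Pi.one_apply, mul_one]
    rfl
  have e2 : pathLaw γ ρ (2 ^ n) {w | ∀ t < 2 ^ n, (w t, w (t + 1)) ∈ S} =
      ∫⁻ x, (weightedOU γ ρ k)^[2 ^ n] 1 x ∂γ := by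
    rw [← lintegral_pathLaw_prod hkm _ measurable_one, ← lintegral_indicator_one]
    · refine lintegral_congr fun w => ?_
      simp only [Pi.one_apply, mul_one, hk, Set.indicator_apply, Set.mem_ofPred_eq]
      split_ifs with h
      · refine (Finset.prod_eq_one fun t ht => ?_).symm
        rw [if_pos (h t (Finset.mem_range.mp ht))]
      · push Not at h
        obtain ⟨t, ht, hw⟩ := h
        exact (Finset.prod_eq_zero (Finset.mem_range.mpr ht) (if_neg hw)).symm
    · simp only [Set.ofPred_forall]
      refine MeasurableSet.iInter fun t => MeasurableSet.iInter fun _ => ?_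
      exact ((measurable_pi_apply t).prodMk (measurable_pi_apply (t + 1))) hS
  rw [e1, e2]
  exact hγ.pow_le_lintegral_iterate h0 h1 hkm hks n

/-- The chain for a product measure is the product of the chains. -/
theorem measurePreserving_pathLaw_pi {ι : Type*} [Fintype ι] (ρ : ℝ) (T : ℕ) :
    MeasurePreserving (fun (v : ι → ℕ → E) (t : ℕ) (i : ι) => v i t)
      (Measure.pi fun _ : ι => pathLaw γ ρ T) (pathLaw (Measure.pi fun _ : ι => γ) ρ T) := by
  have hm : Measurable fun (v : ι → ℕ → E) (t : ℕ) (i : ι) => v i t :=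
    measurable_pi_lambda _ fun t => measurable_pi_lambda _ fun i =>
      (measurable_pi_apply t).comp (measurable_pi_apply i)
  refine ⟨hm, ?_⟩
  induction T with
  | zero =>
    have h1 : MeasurePreserving (fun (x : ι → E) i (_ : ℕ) => x i) (Measure.pi fun _ : ι => γ)
        (Measure.pi fun _ : ι => pathLaw γ ρ 0) :=
      measurePreserving_pi _ _ fun _ => ⟨measurable_const_path, rfl⟩
    rw [← h1.map_eq, Measure.map_map hm h1.measurable]
    rfl
  | succ T ih =>
    have h1 : MeasurePreserving (fun (x : ι → (ℕ → E) × E) i => pathStep ρ T (x i))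
        (Measure.pi fun _ : ι => (pathLaw γ ρ T).prod γ)
        (Measure.pi fun _ : ι => pathLaw γ ρ (T + 1)) :=
      measurePreserving_pi _ _ fun _ => measurePreserving_pathStep ρ T
    have h2 := (measurePreserving_arrowProdEquivProdArrow (ℕ → E) E ι
      (fun _ => pathLaw γ ρ T) (fun _ => γ)).symm _
    have h3 : MeasurePreserving (Prod.map (fun (v : ι → ℕ → E) (t : ℕ) (i : ι) => v i t) id)
        ((Measure.pi fun _ : ι => pathLaw γ ρ T).prod (Measure.pi fun _ : ι => γ))
        ((pathLaw (Measure.pi fun _ : ι => γ) ρ T).prod (Measure.pi fun _ : ι => γ)) :=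
      (⟨hm, ih⟩ : MeasurePreserving _ _ _).prod (MeasurePreserving.id _)
    have h4 := (measurePreserving_pathStep (γ := Measure.pi fun _ : ι => γ) ρ T).comp h3
    have h5 := h1.comp h2
    rw [← h5.map_eq, Measure.map_map hm h5.measurable, ← h4.map_eq]
    congr 1
    ext p t i
    simp only [Function.comp_apply, pathStep, Prod.map]
    split_ifs <;> rfl

end PathLaw

/-! ### Probability that fixed points solve the constraints along the chain -/

/-- The values at times `s ≤ t` form a Gaussian pair with covariance `ρ^(t-s)`; the induction
integrates out the last innovation. -/
theorem lintegral_exp_gaussian_pair {ρ : ℝ} (h0 : 0 ≤ ρ) (h1 : ρ ≤ 1) {s t T : ℕ} (hst : s ≤ t)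
    (htT : t ≤ T) (a b : ℝ) :
    ∫⁻ w, ENNReal.ofReal (Real.exp (a * w s + b * w t)) ∂(pathLaw (gaussianReal 0 1) ρ T) =
      ENNReal.ofReal (Real.exp ((a ^ 2 + b ^ 2 + 2 * a * b * ρ ^ (t - s)) / 2)) := by
  have hexp : ∀ a : ℝ, ∫⁻ x, ENNReal.ofReal (Real.exp (a * x)) ∂(gaussianReal 0 1) =
      ENNReal.ofReal (Real.exp (a ^ 2 / 2)) := by
    intro a
    rw [← ofReal_integral_eq_lintegral_ofReal (integrable_exp_mul_gaussianReal a)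
      (ae_of_all _ fun x => (Real.exp_pos _).le)]
    have := congrFun (mgf_id_gaussianReal (μ := 0) (v := 1)) a
    simp only [mgf, id] at this
    rw [this]; simp
  have hm : ∀ s t, Measurable fun w : ℕ → ℝ => ENNReal.ofReal (Real.exp (a * w s + b * w t)) :=
    fun s t => by fun_prop
  induction T generalizing s t a b with
  | zero =>
    obtain rfl : t = 0 := by omega
    obtain rfl : s = 0 := by omega
    rw [pathLaw, lintegral_map (hm 0 0) measurable_const_path]
    simp_rw [← add_mul]
    rw [hexp]
    congr 2; simp; ring
  | succ T ih =>
    rw [lintegral_pathLaw_succ ρ T (hm s t)]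
    rcases htT.lt_or_eq with h | rfl
    · have h := Nat.lt_succ_iff.mp h
      simp_rw [pathStep_of_le h, pathStep_of_le (hst.trans h)]
      simp only [lintegral_const, measure_univ, mul_one]
      exact ih hst h a b (fun s t => by fun_prop)
    · have hsq := sq_add_sq_sqrt h0 h1
      set r := √(1 - ρ ^ 2) with hr
      rcases hst.lt_or_eq with h | rfl
      · have h := Nat.lt_succ_iff.mp h
        have : ∀ w : ℕ → ℝ, ∫⁻ z, ENNReal.ofReal (Real.exp (a * pathStep ρ T (w, z) s +
            b * pathStep ρ T (w, z) (T + 1))) ∂(gaussianReal 0 1) =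
            ENNReal.ofReal (Real.exp (a * w s + (b * ρ) * w T)) *
              ENNReal.ofReal (Real.exp ((b * r) ^ 2 / 2)) := by
          intro w
          rw [← hexp, ← lintegral_const_mul _ (by fun_prop)]
          refine lintegral_congr fun z => ?_
          rw [← ENNReal.ofReal_mul (Real.exp_pos _).le, ← Real.exp_add, pathStep_of_le h,
            pathStep_succ, ouStep, ← hr, smul_eq_mul, smul_eq_mul]
          congr 2; ring
        simp_rw [this]
        rw [lintegral_mul_const _ (by fun_prop), ih h le_rfl a (b * ρ) (fun s t => by fun_prop),
          ← ENNReal.ofReal_mul (Real.exp_pos _).le, ← Real.exp_add]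
        congr 2
        rw [show T + 1 - s = (T - s) + 1 by omega, pow_succ]
        linear_combination b ^ 2 / 2 * hsq
      · have : ∀ w : ℕ → ℝ, ∫⁻ z, ENNReal.ofReal (Real.exp (a * pathStep ρ T (w, z) (T + 1) +
            b * pathStep ρ T (w, z) (T + 1))) ∂(gaussianReal 0 1) =
            ENNReal.ofReal (Real.exp (((a + b) * ρ) * w T + 0 * w T)) *
              ENNReal.ofReal (Real.exp (((a + b) * r) ^ 2 / 2)) := by
          intro w
          rw [← hexp, ← lintegral_const_mul _ (by fun_prop)]
          refine lintegral_congr fun z => ?_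
          rw [← ENNReal.ofReal_mul (Real.exp_pos _).le, ← Real.exp_add,
            pathStep_succ, ouStep, ← hr, smul_eq_mul, smul_eq_mul]
          congr 2; ring
        simp_rw [this]
        rw [lintegral_mul_const _ (by fun_prop), ih le_rfl le_rfl _ 0 (fun s t => by fun_prop),
          ← ENNReal.ofReal_mul (Real.exp_pos _).le, ← Real.exp_add]
        congr 2
        simp only [tsub_self, pow_zero]
        linear_combination (a + b) ^ 2 / 2 * hsq

/-- Bonferroni: the union has probability at least `m q - m(m-1) r / 2`, and `hqr` makes the
correction at most half of the main term. -/
theorem measureReal_biInter_compl_le {Ω : Type*} [MeasurableSpace Ω] {μ : Measure Ω}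
    [IsProbabilityMeasure μ] {A : ℕ → Set Ω} (hA : ∀ i, MeasurableSet (A i)) (m : ℕ) {q r : ℝ}
    (hq : ∀ i < m, q ≤ μ.real (A i)) (hr : ∀ i < m, ∀ j < i, μ.real (A j ∩ A i) ≤ r)
    (hqr : (m - 1) * r ≤ q) : μ.real (⋂ i ∈ Finset.range m, (A i)ᶜ) ≤ 1 - m * q / 2 := by
  have key : ∀ n ≤ m, n * q - n * (n - 1) / 2 * r ≤ μ.real (⋃ i ∈ Finset.range n, A i) := by
    intro n hn
    induction n with
    | zero => simp
    | succ n ih =>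
      have h1 : μ.real ((⋃ i ∈ Finset.range n, A i) ∩ A n) ≤ n * r := by
        rw [Set.iUnion₂_inter]
        refine (measureReal_biUnion_finset_le _ _).trans ?_
        refine (Finset.sum_le_card_nsmul _ _ r fun i hi => ?_).trans (by simp)
        exact hr n hn i (Finset.mem_range.mp hi)
      have h2 := measureReal_union_add_inter (μ := μ) (s := ⋃ i ∈ Finset.range n, A i) (hA n)
        (measure_ne_top _ _)
      have h3 : (⋃ i ∈ Finset.range (n + 1), A i) = (⋃ i ∈ Finset.range n, A i) ∪ A n := by
        rw [Finset.range_add_one, Finset.set_biUnion_insert, Set.union_comm]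
      rw [h3]
      have := ih (by omega)
      have := hq n hn
      push_cast
      nlinarith
  have h1 := key m le_rfl
  have h2 : (⋂ i ∈ Finset.range m, (A i)ᶜ) = (⋃ i ∈ Finset.range m, A i)ᶜ := by simp
  rw [h2, probReal_compl_eq_one_sub ((Finset.range m).measurableSet_biUnion fun i _ => hA i)]
  have : (0 : ℝ) ≤ m := by positivity
  nlinarith

theorem lintegral_pi_prod_eq_prod {ι α : Type*} [Fintype ι] [MeasurableSpace α] {μ : Measure α}
    [IsProbabilityMeasure μ] {f : ι → α → ENNReal} (hf : ∀ i, Measurable (f i)) :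
    ∫⁻ x : ι → α, ∏ i, f i (x i) ∂(Measure.pi fun _ => μ) = ∏ i, ∫⁻ x, f i x ∂μ := by
  rw [lintegral_prod_eq_prod_lintegral_of_indepFun Finset.univ (fun i (x : ι → α) => f i (x i))
    (iIndepFun_pi fun i => (hf i).aemeasurable) fun i => (hf i).comp (measurable_pi_apply i)]
  exact Finset.prod_congr rfl fun i _ =>
    (measurePreserving_eval (fun _ : ι => μ) i).lintegral_comp (hf i)

theorem map_linearForm_pi_gaussian {N : ℕ} (hN : 0 < N) {σ : Fin N → ℝ} (hσ : σ ∈ cube N) :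
    MeasurePreserving (fun g : Fin N → ℝ => (∑ j, g j * σ j) / √N)
      (Measure.pi fun _ => gaussianReal 0 1) (gaussianReal 0 1) := by
  have hm : Measurable fun g : Fin N → ℝ => (∑ j, g j * σ j) / √N := by fun_prop
  refine ⟨hm, ?_⟩
  have hs : ∀ j, σ j ^ 2 = 1 := fun j => by rcases hσ j with h | h <;> simp [h]
  have hN' : (0 : ℝ) < N := by exact_mod_cast hN
  set v : EuclideanSpace ℝ (Fin N) := WithLp.toLp 2 fun j => σ j / √N with hv
  have hnorm : ‖v‖ ^ 2 = 1 := by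
    rw [EuclideanSpace.real_norm_sq_eq]
    simp [hv, div_pow, hs, hN'.ne']
  have h1 : (fun g : Fin N → ℝ => (∑ j, g j * σ j) / √N) =
      (innerSL ℝ v) ∘ (WithLp.toLp 2 : (Fin N → ℝ) → EuclideanSpace ℝ (Fin N)) := by
    ext g
    simp only [Function.comp_apply, innerSL_apply_apply, PiLp.inner_apply, hv, Finset.sum_div]
    refine Finset.sum_congr rfl fun j _ => ?_
    simp; ring
  rw [h1, ← Measure.map_map (innerSL ℝ v).continuous.measurable (by fun_prop),
    map_pi_eq_stdGaussian, IsGaussian.map_eq_gaussianReal, integral_strongDual_stdGaussian,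
    variance_dual_stdGaussian]
  congr 1
  rw [innerSL_apply_norm, hnorm]; simp

theorem pathLaw_row_lt {N : ℕ} (hN : 0 < N) {σ : Fin N → ℝ} (hσ : σ ∈ cube N) {ρ : ℝ}
    (h0 : 0 ≤ ρ) (h1 : ρ ≤ 1) {t T : ℕ} (ht : t ≤ T) (κ : ℝ) :
    (pathLaw (Measure.pi fun _ : Fin N => gaussianReal 0 1) ρ T)
      {w | (∑ j, w t j * σ j) / √N < κ} = gaussianReal 0 1 (Set.Iio κ) :=
  ((map_linearForm_pi_gaussian hN hσ).comp
    (rotationInvariant_gaussianReal.pi.measurePreserving_eval_pathLaw h0 h1 ht)).measure_preimage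
      measurableSet_Iio.nullMeasurableSet

/-- The two normalised products are standard Gaussians whose correlation is the time-discounted
overlap in `hsep`. A Chernoff bound on their sum gains the factor `1 + δ` in the exponent over a
single constraint. -/
theorem pathLaw_row_lt_inter {N : ℕ} (hN : 0 < N) {σ τ : Fin N → ℝ} (hσ : σ ∈ cube N)
    (hτ : τ ∈ cube N) {ρ : ℝ} (h0 : 0 ≤ ρ) (h1 : ρ ≤ 1) {s t T : ℕ} (hst : s ≤ t) (ht : t ≤ T)
    {κ δ : ℝ} (hκ : κ ≤ 0) (hδ1 : δ < 1)
    (hsep : ρ ^ (t - s) * (∑ j, σ j * τ j) / N ≤ 1 - 2 * δ) :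
    (pathLaw (Measure.pi fun _ : Fin N => gaussianReal 0 1) ρ T)
      ({w | (∑ j, w s j * σ j) / √N < κ} ∩ {w | (∑ j, w t j * τ j) / √N < κ}) ≤
      ENNReal.ofReal (Real.exp (-(κ ^ 2 * (1 + δ) / 2))) := by
  set P := pathLaw (Measure.pi fun _ : Fin N => gaussianReal 0 1) ρ T with hP
  -- The minimiser of the Chernoff exponent `2lκ + l²(2 - 2δ)`, whose minimum is `lκ`.
  set l : ℝ := -κ / (2 * (1 - δ)) with hl
  have hl0 : 0 ≤ l := div_nonneg (by linarith) (by linarith)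
  have hN' : (0 : ℝ) < N := by exact_mod_cast hN
  set F : (ℕ → Fin N → ℝ) → ENNReal := fun w =>
    ENNReal.ofReal (Real.exp (2 * l * κ)) *
      ∏ j, ENNReal.ofReal (Real.exp ((-l * σ j / √N) * w s j + (-l * τ j / √N) * w t j)) with hF
  have hFm : Measurable F := by
    refine measurable_const.mul (Finset.measurable_prod _ fun j _ => ?_)
    fun_prop
  have hmeas : MeasurableSet ({w : ℕ → Fin N → ℝ | (∑ j, w s j * σ j) / √N < κ} ∩
      {w | (∑ j, w t j * τ j) / √N < κ}) :=
    (measurableSet_lt (by fun_prop) measurable_const).inter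
      (measurableSet_lt (by fun_prop) measurable_const)
  have hle : P ({w | (∑ j, w s j * σ j) / √N < κ} ∩ {w | (∑ j, w t j * τ j) / √N < κ}) ≤
      ∫⁻ w, F w ∂P := by
    rw [← lintegral_indicator_one hmeas]
    refine lintegral_mono fun w => ?_
    refine Set.indicator_le (fun w hw => ?_) w
    obtain ⟨hw1, hw2⟩ := hw
    have hw1 : (∑ j, w s j * σ j) / √N < κ := hw1
    have hw2 : (∑ j, w t j * τ j) / √N < κ := hw2
    have : F w = ENNReal.ofReal (Real.exp (2 * l * κ - l * ((∑ j, w s j * σ j) / √N) -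
        l * ((∑ j, w t j * τ j) / √N))) := by
      rw [hF]
      simp only
      rw [← ENNReal.ofReal_prod_of_nonneg fun j _ => (Real.exp_pos _).le, ← Real.exp_sum,
        ← ENNReal.ofReal_mul (Real.exp_pos _).le, ← Real.exp_add, Finset.sum_add_distrib]
      congr 2
      rw [Finset.sum_div, Finset.sum_div, Finset.mul_sum, Finset.mul_sum, sub_sub,
        sub_eq_add_neg, neg_add, ← Finset.sum_neg_distrib, ← Finset.sum_neg_distrib]
      congr 1; congr 1
      · exact Finset.sum_congr rfl fun j _ => by ring
      · exact Finset.sum_congr rfl fun j _ => by ring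
    rw [this, Pi.one_apply, ENNReal.one_le_ofReal]
    refine Real.one_le_exp ?_
    nlinarith
  refine hle.trans ?_
  -- The coordinates of a row evolve as independent scalar chains, so the exponential moment
  -- factorises over `j`.
  have hpi := measurePreserving_pathLaw_pi (γ := gaussianReal 0 1) (ι := Fin N) ρ T
  rw [hP, ← hpi.lintegral_comp hFm]
  simp only [hF]
  rw [lintegral_const_mul _ (Finset.measurable_prod _ fun j _ => by fun_prop),
    lintegral_pi_prod_eq_prod (f := fun j (v : ℕ → ℝ) =>
      ENNReal.ofReal (Real.exp ((-l * σ j / √N) * v s + (-l * τ j / √N) * v t)))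
      fun j => by fun_prop]
  simp_rw [lintegral_exp_gaussian_pair h0 h1 hst ht]
  rw [← ENNReal.ofReal_prod_of_nonneg fun j _ => (Real.exp_pos _).le, ← Real.exp_sum,
        ← ENNReal.ofReal_mul (Real.exp_pos _).le, ← Real.exp_add]
  refine ENNReal.ofReal_le_ofReal (Real.exp_le_exp.mpr ?_)
  have hs : ∀ j, σ j ^ 2 = 1 := fun j => by rcases hσ j with h | h <;> simp [h]
  have ht : ∀ j, τ j ^ 2 = 1 := fun j => by rcases hτ j with h | h <;> simp [h]
  have hsq : √(N : ℝ) ^ 2 = N := Real.sq_sqrt hN'.le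
  have e : ∀ j, ((-l * σ j / √N) ^ 2 + (-l * τ j / √N) ^ 2 +
      2 * (-l * σ j / √N) * (-l * τ j / √N) * ρ ^ (t - s)) / 2 =
      l ^ 2 / N + l ^ 2 * ρ ^ (t - s) / N * (σ j * τ j) := by
    intro j
    calc _ = (l ^ 2 * (σ j ^ 2 + τ j ^ 2) + 2 * l ^ 2 * ρ ^ (t - s) * (σ j * τ j)) /
          (2 * √(N : ℝ) ^ 2) := by ring
      _ = _ := by rw [hs, ht, hsq]; field_simp; ring
  simp_rw [e]
  rw [Finset.sum_add_distrib, ← Finset.mul_sum]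
  simp only [Finset.sum_const, Finset.card_univ, Fintype.card_fin, nsmul_eq_mul]
  have e2 : l ^ 2 * ρ ^ (t - s) / N * (∑ j, σ j * τ j) ≤ l ^ 2 * (1 - 2 * δ) := by
    calc _ = l ^ 2 * (ρ ^ (t - s) * (∑ j, σ j * τ j) / N) := by ring
      _ ≤ _ := by gcongr
  have e3 : N * (l ^ 2 / N) = l ^ 2 := by field_simp
  have e4 : l * (2 * (1 - δ)) = -κ := by rw [hl]; field_simp [(by linarith : (1 - δ) ≠ 0)]
  have e5 : 2 * l * κ + l ^ 2 * (2 - 2 * δ) = l * κ := by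
    linear_combination l * e4
  have e6 : l * κ ≤ -(κ ^ 2 * (1 + δ) / 2) := by
    -- This is `1 + δ ≤ 1/(1 - δ)`.
    have : -κ * (1 + δ) / 2 ≤ l := by
      rw [hl, div_le_div_iff₀ (by norm_num) (by linarith)]
      nlinarith [mul_nonneg (by linarith : 0 ≤ -κ) (sq_nonneg δ)]
    nlinarith
  rw [e3]
  nlinarith

/-- Bonferroni for one row, raised to the power `M` because the rows evolve independently. The
points are fixed in advance; dependence on the disorder is left to a union bound. -/
theorem pathLaw_forall_mem_solutions_le {M N : ℕ} (hN : 0 < N) {ρ : ℝ} (h0 : 0 ≤ ρ) (h1 : ρ ≤ 1)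
    {κ δ : ℝ} (hκ : κ ≤ 0) (hδ1 : δ < 1) {m T : ℕ} {t : ℕ → ℕ} {σ : ℕ → Fin N → ℝ}
    (hσ : ∀ i < m, σ i ∈ cube N) (ht : ∀ i < m, t i ≤ T)
    (hmono : ∀ i < m, ∀ j < i, t j ≤ t i)
    (hsep : ∀ i < m, ∀ j < i, ρ ^ (t i - t j) * (∑ l, σ j l * σ i l) / N ≤ 1 - 2 * δ)
    (hm : (m - 1) * Real.exp (-(κ ^ 2 * (1 + δ) / 2)) ≤ (gaussianReal 0 1).real (Set.Iio κ)) :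
    pathLaw (disorderLaw M N) ρ T {w | ∀ i < m, σ i ∈ solutions (w (t i)) (Set.Ici κ)} ≤
      ENNReal.ofReal (1 - m * (gaussianReal 0 1).real (Set.Iio κ) / 2) ^ M := by
  set γ := Measure.pi fun _ : Fin N => gaussianReal 0 1 with hγ
  set A : ℕ → Set (ℕ → Fin N → ℝ) := fun i => {w | (∑ j, w (t i) j * σ i j) / √N < κ} with hA
  have hAm : ∀ i, MeasurableSet (A i) := fun i => measurableSet_lt (by fun_prop) measurable_const
  have hrow := measureReal_biInter_compl_le (μ := pathLaw γ ρ T) hAm m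
    (q := (gaussianReal 0 1).real (Set.Iio κ)) (r := Real.exp (-(κ ^ 2 * (1 + δ) / 2)))
    (fun i hi => (congrArg ENNReal.toReal
      (pathLaw_row_lt hN (hσ i hi) h0 h1 (ht i hi) κ)).ge)
    (fun i hi j hj => ENNReal.toReal_le_of_le_ofReal (Real.exp_pos _).le
      (pathLaw_row_lt_inter hN (hσ j (hj.trans hi)) (hσ i hi) h0 h1 (hmono i hi j hj) (ht i hi)
        hκ hδ1 (hsep i hi j hj)))
    hm
  have hpi := measurePreserving_pathLaw_pi (γ := γ) (ι := Fin M) ρ T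
  set R := ⋂ i ∈ Finset.range m, (A i)ᶜ with hR
  have hsub : {w : ℕ → Fin M → Fin N → ℝ | ∀ i < m, σ i ∈ solutions (w (t i)) (Set.Ici κ)} ⊆
      {w | ∀ r, (fun s => w s r) ∈ R} := by
    intro w hw r
    simp only [hR, Finset.mem_range, Set.mem_iInter]
    intro i hi
    exact not_lt.mpr (Set.mem_Ici.mp ((hw i hi).2 r))
  have hRm : MeasurableSet R := (Finset.range m).measurableSet_biInter fun i _ => (hAm i).compl
  have hm2 : MeasurableSet {w : ℕ → Fin M → Fin N → ℝ | ∀ r, (fun s => w s r) ∈ R} := by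
    rw [Set.ofPred_forall]
    refine MeasurableSet.iInter fun r => ?_
    exact (show Measurable fun (w : ℕ → Fin M → Fin N → ℝ) (s : ℕ) => w s r by fun_prop) hRm
  refine (measure_mono hsub).trans ?_
  rw [show disorderLaw M N = Measure.pi fun _ : Fin M => γ from rfl,
    ← hpi.measure_preimage hm2.nullMeasurableSet]
  have e : (fun (v : Fin M → ℕ → Fin N → ℝ) (t : ℕ) (i : Fin M) => v i t) ⁻¹'
      {w : ℕ → Fin M → Fin N → ℝ | ∀ r, (fun s => w s r) ∈ R} = Set.univ.pi fun _ => R := by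
    ext v
    simp only [Set.mem_univ_pi]
    rfl
  rw [e, Measure.pi_pi, Finset.prod_const, Finset.card_univ, Fintype.card_fin]
  gcongr
  rw [← ofReal_measureReal]
  exact ENNReal.ofReal_le_ofReal hrow

/-! ### Separated times and counting of clusters -/

/-- The point of the cube with the given sign pattern. -/
def cubePoint {N : ℕ} (b : Fin N → Bool) : Fin N → ℝ := fun j => if b j then 1 else -1

theorem cubePoint_mem {N : ℕ} (b : Fin N → Bool) : cubePoint b ∈ cube N := by
  intro j
  unfold cubePoint
  split_ifs <;> simp

theorem sum_cubePoint_mul {N : ℕ} (b c : Fin N → Bool) :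
    ∑ j, cubePoint b j * cubePoint c j = N - 2 * hammingDist b c := by
  have : ∀ j, cubePoint b j * cubePoint c j = 1 - 2 * (if b j ≠ c j then 1 else 0) := by
    intro j
    unfold cubePoint
    cases b j <;> cases c j <;> norm_num
  simp_rw [this]
  rw [Finset.sum_sub_distrib, ← Finset.mul_sum, Finset.sum_boole]
  simp [hammingDist]

/-- Along a slowly moving path there are times at which the points visited are pairwise separated
once time decorrelation is taken into account, but each is close to an earlier one. -/
theorem exists_separated_times {N : ℕ} (hN : 0 < N) {ρ δ : ℝ} (h0 : 0 ≤ ρ) (h1 : ρ ≤ 1)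
    (hδ0 : 0 < δ) (hδ1 : 2 * δ ≤ 1) {g T : ℕ} (hg : ρ ^ g ≤ 1 - 2 * δ) (x : ℕ → Fin N → Bool)
    (hx : ∀ t < T, (hammingDist (x t) (x (t + 1)) : ℝ) ≤ δ * N) (n : ℕ) (hT : n * g ≤ T) :
    ∃ t : ℕ → ℕ, (∀ i ≤ n, t i ≤ i * g) ∧ (∀ i ≤ n, ∀ j < i, t j ≤ t i) ∧
      (∀ i ≤ n, ∀ j < i, ρ ^ (t i - t j) *
        (∑ l, cubePoint (x (t j)) l * cubePoint (x (t i)) l) / N ≤ 1 - 2 * δ) ∧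
      ∀ i ≤ n, i ≠ 0 → ∃ j < i, (hammingDist (x (t i)) (x (t j)) : ℝ) ≤ 2 * δ * N := by
  classical
  have hN' : (0 : ℝ) < N := by exact_mod_cast hN
  induction n with
  | zero =>
    refine ⟨fun _ => 0, ?_, ?_, ?_, ?_⟩ <;> intro i hi
    · simp
    · intro j hj; omega
    · intro j hj; omega
    · intro h; omega
  | succ n ih =>
    obtain ⟨t, ht1, ht2, ht3, ht4⟩ := ih (by rw [add_mul] at hT; omega)
    -- Greedy choice: the next time is the first one after `t n` at which the discounted overlap
    -- with every earlier point is at most `1 - 2δ`.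
    set Q : ℕ → Prop := fun s => t n ≤ s ∧ ∀ j ≤ n, ρ ^ (s - t j) *
        (∑ l, cubePoint (x (t j)) l * cubePoint (x s) l) / N ≤ 1 - 2 * δ with hQ
    have htn : ∀ j ≤ n, t j ≤ t n := fun j hj => by
      rcases hj.lt_or_eq with h | rfl
      · exact ht2 n le_rfl j h
      · exact le_rfl
    have hex : Q (t n + g) := by
      refine ⟨by omega, fun j hj => ?_⟩
      have e : ρ ^ (t n + g - t j) ≤ ρ ^ g :=
        pow_le_pow_of_le_one h0 h1 (by have := htn j hj; omega)
      have p : 0 ≤ ρ ^ (t n + g - t j) := pow_nonneg h0 _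
      rw [sum_cubePoint_mul, div_le_iff₀ hN']
      have : (0 : ℝ) ≤ hammingDist (x (t j)) (x (t n + g)) := by positivity
      nlinarith
    have hex' : ∃ s, Q s := ⟨_, hex⟩
    set s := Nat.find hex' with hs
    have hsQ : Q s := Nat.find_spec hex'
    have hs1 : s ≤ t n + g := Nat.find_min' hex' hex
    have hs2 : s ≤ (n + 1) * g := by have := ht1 n le_rfl; rw [add_mul]; omega
    -- At time `t n` itself the overlap with the last point is `1 > 1 - 2δ`.
    have hne : s ≠ t n := by
      intro h
      have := hsQ.2 n le_rfl
      rw [h, sum_cubePoint_mul, hammingDist_self, tsub_self, pow_zero] at this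
      field_simp at this
      simp at this
      nlinarith
    have hlt : t n < s := lt_of_le_of_ne hsQ.1 hne.symm
    -- By minimality, at time `s - 1` the path is still within `δN` of some earlier point; one more
    -- step adds at most `δN`.
    have hnQ : ¬ Q (s - 1) := Nat.find_min hex' (by omega)
    obtain ⟨j, hj, hjs⟩ : ∃ j ≤ n, (hammingDist (x (t j)) (x (s - 1)) : ℝ) ≤ δ * N := by
      by_contra hcon
      push Not at hcon
      refine hnQ ⟨by omega, fun j hj => ?_⟩
      have hd := hcon j hj
      rw [sum_cubePoint_mul, div_le_iff₀ hN']
      have p0 : 0 ≤ ρ ^ (s - 1 - t j) := pow_nonneg h0 _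
      have p1 : ρ ^ (s - 1 - t j) ≤ 1 := pow_le_one₀ h0 h1
      have p2 : (0 : ℝ) ≤ (1 - 2 * δ) * N := mul_nonneg (by linarith) hN'.le
      calc _ ≤ ρ ^ (s - 1 - t j) * ((1 - 2 * δ) * N) := by
            refine mul_le_mul_of_nonneg_left ?_ p0
            nlinarith
        _ ≤ _ := by nlinarith
    refine ⟨fun i => if i ≤ n then t i else s, ?_, ?_, ?_, ?_⟩ <;> intro i hi
    · rcases hi.lt_or_eq with h | rfl
      · simp only [if_pos (Nat.lt_succ_iff.mp h)]; exact ht1 i (by omega)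
      · simpa using hs2
    · intro j' hj'
      rcases hi.lt_or_eq with h | rfl
      · simp only [if_pos (Nat.lt_succ_iff.mp h), if_pos (show j' ≤ n by omega)]
        exact ht2 i (by omega) j' hj'
      · simp only [if_neg (show ¬ n + 1 ≤ n by omega), if_pos (show j' ≤ n by omega)]
        exact (htn j' (by omega)).trans hsQ.1
    · intro j' hj'
      rcases hi.lt_or_eq with h | rfl
      · simp only [if_pos (Nat.lt_succ_iff.mp h), if_pos (show j' ≤ n by omega)]
        exact ht3 i (by omega) j' hj'
      · simp only [if_neg (show ¬ n + 1 ≤ n by omega), if_pos (show j' ≤ n by omega)]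
        exact hsQ.2 j' (by omega)
    · intro h0
      rcases hi.lt_or_eq with h | rfl
      · obtain ⟨j', hj', hh⟩ := ht4 i (by omega) h0
        refine ⟨j', hj', ?_⟩
        simpa only [if_pos (Nat.lt_succ_iff.mp h), if_pos (show j' ≤ n by omega)] using hh
      · refine ⟨j, by omega, ?_⟩
        simp only [if_neg (show ¬ n + 1 ≤ n by omega), if_pos hj]
        have h3 := hx (s - 1) (by omega)
        rw [Nat.sub_add_cancel (by omega)] at h3
        have h4 := hammingDist_triangle (x s) (x (s - 1)) (x (t j))
        rw [hammingDist_comm (x s) (x (s - 1)), hammingDist_comm (x (s - 1)) (x (t j))] at h4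
        have h5 : (hammingDist (x s) (x (t j)) : ℝ) ≤
            hammingDist (x (s - 1)) (x s) + hammingDist (x (t j)) (x (s - 1)) := by
          exact_mod_cast h4
        linarith

/-- Exponential Markov for counting: weight each point by `exp(-l · distance)`; the total weight is
`(1 + exp(-l))^N`. The parameter `l` is left free and tuned at the end. -/
theorem card_hammingBall_le {N : ℕ} {l : ℝ} (hl : 0 ≤ l) (r : ℝ) (b : Fin N → Bool) :
    ((Finset.univ.filter fun c : Fin N → Bool => (hammingDist c b : ℝ) ≤ r).card : ℝ) ≤
      Real.exp (l * r + N * Real.exp (-l)) := by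
  classical
  have hsum : ∑ c : Fin N → Bool, Real.exp (-l * hammingDist c b) = (1 + Real.exp (-l)) ^ N := by
    have h1 : ∀ c : Fin N → Bool, Real.exp (-l * hammingDist c b) =
        ∏ j, if c j ≠ b j then Real.exp (-l) else 1 := by
      intro c
      rw [Finset.prod_ite, Finset.prod_const, Finset.prod_const_one, mul_one, ← Real.exp_nat_mul,
        mul_comm]
      rfl
    simp_rw [h1]
    have h2 := Finset.prod_univ_sum (fun _ : Fin N => (Finset.univ : Finset Bool))
      (fun j β => if β ≠ b j then Real.exp (-l) else 1)
    rw [Fintype.piFinset_univ] at h2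
    rw [← h2]
    have h3 : ∀ j, ∑ β : Bool, (if β ≠ b j then Real.exp (-l) else 1) = 1 + Real.exp (-l) := by
      intro j
      cases b j <;> simp [add_comm]
    rw [Finset.prod_congr rfl fun j _ => h3 j]
    simp
  have h4 : ((Finset.univ.filter fun c : Fin N → Bool => (hammingDist c b : ℝ) ≤ r).card : ℝ) *
      Real.exp (-l * r) ≤ (1 + Real.exp (-l)) ^ N := by
    rw [← hsum, ← nsmul_eq_mul]
    refine (Finset.card_nsmul_le_sum _ (fun c => Real.exp (-l * hammingDist c b)) _
      fun c hc => ?_).trans (Finset.sum_le_univ_sum_of_nonneg fun c => (Real.exp_pos _).le)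
    refine Real.exp_le_exp.mpr ?_
    have := (Finset.mem_filter.mp hc).2
    nlinarith
  have h5 : (1 + Real.exp (-l)) ^ N ≤ Real.exp (N * Real.exp (-l)) := by
    rw [Real.exp_nat_mul]
    refine pow_le_pow_left₀ (by positivity) ?_ N
    rw [add_comm]; exact Real.add_one_le_exp _
  rw [Real.exp_add]
  have h6 : Real.exp (l * r) * Real.exp (-l * r) = 1 := by
    rw [← Real.exp_add]; simp
  calc _ = Real.exp (l * r) * (((Finset.univ.filter fun c : Fin N → Bool =>
        (hammingDist c b : ℝ) ≤ r).card : ℝ) * Real.exp (-l * r)) := by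
        rw [mul_left_comm, h6, mul_one]
    _ ≤ _ := by gcongr; exact h4.trans h5

/-- Tuples of sign patterns in which every entry but the first is close to an earlier one. -/
def clusters (N n : ℕ) (r : ℝ) : Finset (Fin (n + 1) → Fin N → Bool) :=
  open Classical in
  Finset.univ.filter fun σ => ∀ i, i ≠ 0 → ∃ j < i, (hammingDist (σ i) (σ j) : ℝ) ≤ r

/-- Drop the last entry: the rest is a smaller cluster, and the dropped entry lies in one of the
balls around its entries. -/
theorem card_clusters_le {N : ℕ} {l : ℝ} (hl : 0 ≤ l) (r : ℝ) (n : ℕ) :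
    ((clusters N n r).card : ℝ) ≤
      2 ^ N * ((n + 1) * Real.exp (l * r + N * Real.exp (-l))) ^ n := by
  classical
  set V := Real.exp (l * r + N * Real.exp (-l)) with hV
  have hV0 : 0 < V := Real.exp_pos _
  induction n with
  | zero =>
    have : (clusters N 0 r).card ≤ 2 ^ N := by
      refine (Finset.card_le_univ _).trans ?_
      simp
    simp only [pow_zero, mul_one]
    exact_mod_cast this
  | succ n ih =>
    have hmaps : ∀ σ ∈ clusters N (n + 1) r, Fin.init σ ∈ clusters N n r := by
      intro σ hσ
      simp only [clusters, Finset.mem_filter, Finset.mem_univ, true_and] at hσ ⊢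
      intro i hi
      obtain ⟨j, hj, hd⟩ := hσ i.castSucc (by
        intro h; apply hi; ext; simpa using congrArg Fin.val h)
      have hjn : j.val < n + 1 := by have : j.val < i.val := hj; omega
      exact ⟨⟨j, hjn⟩, hj, hd⟩
    have hfib : ∀ τ ∈ clusters N n r,
        (((clusters N (n + 1) r).filter fun σ => Fin.init σ = τ).card : ℝ) ≤ (n + 1) * V := by
      intro τ _
      have h1 : ((clusters N (n + 1) r).filter fun σ => Fin.init σ = τ).card ≤
          (Finset.univ.biUnion fun j : Fin (n + 1) =>
            Finset.univ.filter fun c : Fin N → Bool => (hammingDist c (τ j) : ℝ) ≤ r).card := by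
        refine Finset.card_le_card_of_injOn (fun σ => σ (Fin.last _)) ?_ ?_
        · intro σ hσ
          simp only [clusters, Finset.coe_filter, Finset.mem_filter, Finset.mem_univ,
            true_and, Set.mem_ofPred_eq] at hσ
          obtain ⟨h, rfl⟩ := hσ
          obtain ⟨j, hj, hd⟩ := h (Fin.last _) (Fin.last_pos).ne'
          simp only [Finset.coe_biUnion, Set.mem_iUnion, Finset.coe_filter, Finset.mem_univ,
            true_and, Set.mem_ofPred_eq]
          exact ⟨⟨j, hj⟩, by simp, hd⟩
        · intro σ hσ σ' hσ' h
          have e1 := (Finset.mem_filter.mp hσ).2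
          have e2 := (Finset.mem_filter.mp hσ').2
          rw [← Fin.snoc_init_self σ, ← Fin.snoc_init_self σ', e1, e2]
          exact congrArg _ h
      calc _ ≤ (((Finset.univ.biUnion fun j : Fin (n + 1) => Finset.univ.filter
            fun c : Fin N → Bool => (hammingDist c (τ j) : ℝ) ≤ r).card : ℕ) : ℝ) := by
            exact_mod_cast h1
        _ ≤ ∑ j : Fin (n + 1), ((Finset.univ.filter
            fun c : Fin N → Bool => (hammingDist c (τ j) : ℝ) ≤ r).card : ℝ) := by
            exact_mod_cast Finset.card_biUnion_le
        _ ≤ ∑ j : Fin (n + 1), V := Finset.sum_le_sum fun j _ => card_hammingBall_le hl r _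
        _ = _ := by simp
    have h2 := Finset.card_eq_sum_card_fiberwise hmaps
    calc ((clusters N (n + 1) r).card : ℝ) = ∑ τ ∈ clusters N n r,
          (((clusters N (n + 1) r).filter fun σ => Fin.init σ = τ).card : ℝ) := by
          rw [h2]; push_cast; rfl
      _ ≤ (clusters N n r).card * ((n + 1) * V) := by
          refine (Finset.sum_le_card_nsmul _ _ _ hfib).trans ?_
          rw [nsmul_eq_mul]
      _ ≤ 2 ^ N * ((n + 1) * V) ^ n * ((n + 1) * V) := by gcongr
      _ = 2 ^ N * ((n + 1) * V) ^ (n + 1) := by ring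
      _ ≤ _ := by
          push_cast
          gcongr
          linarith

/-! ### Upper bound for stable, successful paths -/

/-- Pairs of disorders on which `a` outputs two solutions at Hamming distance at most `r`. -/
def stablePairs {M N : ℕ} (κ r : ℝ) (a : (Fin M → Fin N → ℝ) → Fin N → Bool) :
    Set ((Fin M → Fin N → ℝ) × (Fin M → Fin N → ℝ)) :=
  {p | cubePoint (a p.1) ∈ solutions p.1 (Set.Ici κ) ∧
    cubePoint (a p.2) ∈ solutions p.2 (Set.Ici κ) ∧ (hammingDist (a p.1) (a p.2) : ℝ) ≤ r}

/-- Union bound over the separated times and over the clusters formed by the outputs at these times,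
which removes the dependence of the outputs on the disorder. -/
theorem pathLaw_stablePairs_le {M N : ℕ} (hN : 0 < N) {ρ : ℝ} (h0 : 0 ≤ ρ) (h1 : ρ ≤ 1)
    {κ δ l : ℝ} (hκ : κ ≤ 0) (hδ0 : 0 < δ) (hδ1 : 2 * δ ≤ 1) (hl : 0 ≤ l) {n g T : ℕ}
    (hg : ρ ^ g ≤ 1 - 2 * δ) (hT : n * g ≤ T) (hT0 : 0 < T)
    (hn : n * Real.exp (-(κ ^ 2 * (1 + δ) / 2)) ≤ (gaussianReal 0 1).real (Set.Iio κ))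
    (a : (Fin M → Fin N → ℝ) → Fin N → Bool) :
    pathLaw (disorderLaw M N) ρ T {w | ∀ t < T, (w t, w (t + 1)) ∈ stablePairs κ (δ * N) a} ≤
      ENNReal.ofReal ((T + 1) ^ (n + 1) *
        (2 ^ N * ((n + 1) * Real.exp (l * (2 * δ * N) + N * Real.exp (-l))) ^ n) *
        Real.exp (-(M * ((n + 1) * (gaussianReal 0 1).real (Set.Iio κ) / 2)))) := by
  classical
  set q := (gaussianReal 0 1).real (Set.Iio κ) with hq
  set m := n + 1 with hm
  set P := pathLaw (disorderLaw M N) ρ T with hP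
  set C := clusters N n (2 * δ * N) with hC
  set sep : (Fin m → Fin (T + 1)) → (Fin m → Fin N → Bool) → Prop := fun t σ =>
    (∀ i, ∀ j < i, (t j).val ≤ (t i).val) ∧ ∀ i, ∀ j < i, ρ ^ ((t i).val - (t j).val) *
      (∑ l, cubePoint (σ j) l * cubePoint (σ i) l) / N ≤ 1 - 2 * δ with hsep
  have hsub : {w : ℕ → Fin M → Fin N → ℝ | ∀ t < T, (w t, w (t + 1)) ∈ stablePairs κ (δ * N) a} ⊆
      ⋃ t ∈ (Finset.univ : Finset (Fin m → Fin (T + 1))), ⋃ σ ∈ C,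
        {w | sep t σ ∧ ∀ i, cubePoint (σ i) ∈ solutions (w (t i)) (Set.Ici κ)} := by
    intro w hw
    have hsol : ∀ t ≤ T, cubePoint (a (w t)) ∈ solutions (w t) (Set.Ici κ) := by
      intro t ht
      rcases ht.lt_or_eq with h | rfl
      · exact (hw t h).1
      · have := (hw (t - 1) (by omega)).2.1
        rwa [Nat.sub_add_cancel hT0] at this
    obtain ⟨t, ht1, ht2, ht3, ht4⟩ := exists_separated_times hN h0 h1 hδ0 hδ1 hg
      (fun t => a (w t)) (fun t ht => (hw t ht).2.2) n hT
    have htT : ∀ i : Fin m, t i ≤ T := fun i => (ht1 i (by omega)).trans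
      ((Nat.mul_le_mul_right g (by omega)).trans hT)
    simp only [Set.mem_iUnion]
    refine ⟨fun i => ⟨t i, by have := htT i; omega⟩, Finset.mem_univ _, fun i => a (w (t i)),
      ?_, ⟨fun i j hj => ht2 i (by omega) j hj, fun i j hj => ht3 i (by omega) j hj⟩,
      fun i => hsol _ (htT i)⟩
    simp only [hC, clusters, Finset.mem_filter, Finset.mem_univ, true_and]
    intro i hi
    obtain ⟨j, hj, hd⟩ := ht4 i (by omega) (fun h => hi (Fin.ext h))
    exact ⟨⟨j, by omega⟩, hj, hd⟩
  have hbound : ∀ t : Fin m → Fin (T + 1), ∀ σ : Fin m → Fin N → Bool,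
      P {w | sep t σ ∧ ∀ i, cubePoint (σ i) ∈ solutions (w (t i)) (Set.Ici κ)} ≤
        ENNReal.ofReal (Real.exp (-(M * (m * q / 2)))) := by
    intro t σ
    by_cases hs : sep t σ
    · have e : ∀ i : Fin m, Fin.ofNat m i.val = i := fun i => by simp
      have hval : ∀ i < m, (Fin.ofNat m i).val = i := fun i hi => Nat.mod_eq_of_lt hi
      -- The fixed-point bound takes families indexed by `ℕ`; `Fin.ofNat` extends the finite ones,
      -- and only indices below `m` matter.
      have key := pathLaw_forall_mem_solutions_le (M := M) hN h0 h1 hκ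
        (δ := δ) (by linarith) (m := m) (T := T) (t := fun i => (t (Fin.ofNat m i)).val)
        (σ := fun i => cubePoint (σ (Fin.ofNat m i))) (fun i _ => cubePoint_mem _)
        (fun i _ => by omega)
        (fun i hi j hj => hs.1 _ _ (by
          rw [Fin.lt_def, hval i hi, hval j (hj.trans hi)]; exact hj))
        (fun i hi j hj => hs.2 _ _ (by
          rw [Fin.lt_def, hval i hi, hval j (hj.trans hi)]; exact hj))
        (by rw [hm]; push_cast; simpa using hn)
      refine (measure_mono ?_).trans (key.trans ?_)
      · rintro w ⟨-, hw⟩ i hi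
        exact hw _
      · rw [Real.exp_neg, ← Real.exp_neg, ← mul_neg, Real.exp_nat_mul,
          ENNReal.ofReal_pow (Real.exp_pos _).le]
        gcongr
        have := Real.add_one_le_exp (-(m * q / 2))
        linarith
    · have : {w : ℕ → Fin M → Fin N → ℝ |
          sep t σ ∧ ∀ i, cubePoint (σ i) ∈ solutions (w (t i)) (Set.Ici κ)} = ∅ := by
        ext w; simp [hs]
      rw [this]; simp
  calc _ ≤ P (⋃ t ∈ (Finset.univ : Finset (Fin m → Fin (T + 1))), ⋃ σ ∈ C,
        {w | sep t σ ∧ ∀ i, cubePoint (σ i) ∈ solutions (w (t i)) (Set.Ici κ)}) :=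
        measure_mono hsub
    _ ≤ ∑ t : Fin m → Fin (T + 1), ∑ σ ∈ C,
        P {w | sep t σ ∧ ∀ i, cubePoint (σ i) ∈ solutions (w (t i)) (Set.Ici κ)} :=
        (measure_biUnion_finset_le _ _).trans
          (Finset.sum_le_sum fun t _ => measure_biUnion_finset_le _ _)
    _ ≤ ∑ t : Fin m → Fin (T + 1), ∑ σ ∈ C, ENNReal.ofReal (Real.exp (-(M * (m * q / 2)))) :=
        Finset.sum_le_sum fun t _ => Finset.sum_le_sum fun σ _ => hbound t σ
    _ = ENNReal.ofReal ((T + 1) ^ m * C.card * Real.exp (-(M * (m * q / 2)))) := by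
        simp only [Finset.sum_const, Finset.card_univ, Fintype.card_fun, Fintype.card_fin,
          nsmul_eq_mul]
        rw [← ENNReal.ofReal_natCast C.card, ← ENNReal.ofReal_natCast,
          ← ENNReal.ofReal_mul (by positivity), ← ENNReal.ofReal_mul (by positivity)]
        congr 1; push_cast; ring
    _ ≤ _ := by
        refine ENNReal.ofReal_le_ofReal ?_
        have := card_clusters_le (N := N) hl (2 * δ * N) n
        rw [hm]
        push_cast
        gcongr

theorem measurable_cubePoint {α : Type*} [MeasurableSpace α] {N : ℕ} {a : α → Fin N → Bool}
    (ha : Measurable a) (j : Fin N) : Measurable fun G => cubePoint (a G) j := by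
  unfold cubePoint
  have h1 : Measurable fun G => a G j := (measurable_pi_apply j).comp ha
  exact Measurable.ite (h1 (measurableSet_singleton true)) measurable_const measurable_const

theorem measurable_hammingDist {α : Type*} [MeasurableSpace α] {N : ℕ} {a : α → Fin N → Bool}
    (ha : Measurable a) : Measurable fun p : α × α => (hammingDist (a p.1) (a p.2) : ℝ) := by
  have h : ∀ j, Measurable fun G => a G j := fun j => (measurable_pi_apply j).comp ha
  have e : (fun p : α × α => (hammingDist (a p.1) (a p.2) : ℝ)) =
      fun p => ∑ j, if a p.1 j = a p.2 j then 0 else 1 := by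
    ext p
    simp [hammingDist, Finset.sum_ite]
  rw [e]
  exact Finset.measurable_sum _ fun j _ => Measurable.ite (measurableSet_eq_fun
    ((h j).comp measurable_fst) ((h j).comp measurable_snd)) measurable_const measurable_const

theorem measurableSet_stablePairs {M N : ℕ} (κ r : ℝ)
    {a : (Fin M → Fin N → ℝ) → Fin N → Bool} (ha : Measurable a) :
    MeasurableSet (stablePairs κ r a) := by
  have h1 : MeasurableSet {G : Fin M → Fin N → ℝ | cubePoint (a G) ∈ solutions G (Set.Ici κ)} := by
    have : {G : Fin M → Fin N → ℝ | cubePoint (a G) ∈ solutions G (Set.Ici κ)} =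
        ⋂ i, {G | κ ≤ (∑ j, G i j * cubePoint (a G) j) / √N} := by
      ext G
      simp only [solutions, Set.mem_ofPred_eq, Set.mem_Ici, Set.mem_iInter]
      exact ⟨fun h => h.2, fun h => ⟨cubePoint_mem _, h⟩⟩
    rw [this]
    have hb : ∀ j, Measurable fun G => cubePoint (a G) j := measurable_cubePoint ha
    exact MeasurableSet.iInter fun i => measurableSet_le measurable_const (by fun_prop)
  have h2 := measurable_hammingDist ha
  have h3 := (measurable_fst (β := Fin M → Fin N → ℝ) h1).inter
    ((measurable_snd (α := Fin M → Fin N → ℝ) h1).inter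
      (measurableSet_le h2 (measurable_const (a := r))))
  exact h3

/-- No measurable map is stable and successful with a probability that is too large. -/
theorem prob_stablePairs_pow_le {M N : ℕ} (hN : 0 < N) {ρ : ℝ} (h0 : 0 ≤ ρ) (h1 : ρ ≤ 1)
    {κ δ l : ℝ} (hκ : κ ≤ 0) (hδ0 : 0 < δ) (hδ1 : 2 * δ ≤ 1) (hl : 0 ≤ l) {n g k : ℕ}
    (hg : ρ ^ g ≤ 1 - 2 * δ) (hT : n * g ≤ 2 ^ k)
    (hn : n * Real.exp (-(κ ^ 2 * (1 + δ) / 2)) ≤ (gaussianReal 0 1).real (Set.Iio κ))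
    {a : (Fin M → Fin N → ℝ) → Fin N → Bool} (ha : Measurable a) :
    (((disorderLaw M N).prod (disorderLaw M N))
      {p | (p.1, ouStep ρ p.1 p.2) ∈ stablePairs κ (δ * N) a}) ^ (2 ^ k) ≤
      ENNReal.ofReal (((2 ^ k : ℕ) + 1) ^ (n + 1) *
        (2 ^ N * ((n + 1) * Real.exp (l * (2 * δ * N) + N * Real.exp (-l))) ^ n) *
        Real.exp (-(M * ((n + 1) * (gaussianReal 0 1).real (Set.Iio κ) / 2)))) := by
  refine ((rotationInvariant_disorderLaw M N).pow_le_pathLaw h0 h1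
    (measurableSet_stablePairs κ (δ * N) ha) ?_ k).trans
      (pathLaw_stablePairs_le hN h0 h1 hκ hδ0 hδ1 hl hg hT (by positivity) hn a)
  rintro x y ⟨h1, h2, h3⟩
  exact ⟨h2, h1, by rwa [hammingDist_comm]⟩

/-! ### Stability of the rounded algorithm -/

instance : IsProbabilityMeasure (cond (volume : Measure ℝ) (Set.Icc (-1 : ℝ) 1)) :=
  cond_isProbabilityMeasure_of_finite (by simp) (by simp)

instance (N : ℕ) : IsProbabilityMeasure (roundingLaw N) := by
  unfold roundingLaw; infer_instance

open Classical in
/-- The sign pattern of the rounding of `x` with thresholds `U`. -/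
def roundBits {N : ℕ} (U x : Fin N → ℝ) : Fin N → Bool := fun j => decide (U j ≤ x j)

theorem cubePoint_roundBits {N : ℕ} (U x : Fin N → ℝ) :
    cubePoint (roundBits U x) = IsingPerceptron.round U x := by
  ext j; simp [cubePoint, roundBits, IsingPerceptron.round]

theorem measurable_roundBits {N : ℕ} :
    Measurable fun p : (Fin N → ℝ) × (Fin N → ℝ) => roundBits p.1 p.2 := by
  refine measurable_pi_lambda _ fun j => measurable_to_bool ?_
  have : (fun p : (Fin N → ℝ) × (Fin N → ℝ) => roundBits p.1 p.2 j) ⁻¹' {true} =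
      {p | p.1 j ≤ p.2 j} := by
    ext p; simp [roundBits]
  rw [this]
  exact measurableSet_le (by fun_prop) (by fun_prop)

theorem cond_Icc_le_abs_sub (x y : ℝ) :
    cond (volume : Measure ℝ) (Set.Icc (-1 : ℝ) 1) (Set.Ioc (min x y) (max x y)) ≤
      ENNReal.ofReal (|x - y| / 2) := by
  rw [cond_apply measurableSet_Icc, Real.volume_Icc]
  calc _ ≤ (ENNReal.ofReal (1 - -1))⁻¹ * volume (Set.Ioc (min x y) (max x y)) := by
        gcongr; exact Set.inter_subset_right
    _ = _ := by
        rw [Real.volume_Ioc, max_sub_min_eq_abs, ← ENNReal.ofReal_inv_of_pos (by norm_num),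
          ← ENNReal.ofReal_mul (by norm_num), abs_sub_comm]
        congr 1; ring

/-- With shared thresholds, the bits at `j` differ only if `U j` falls between `x j` and `y j`. -/
theorem lintegral_hammingDist_roundBits_le {N : ℕ} (x y : Fin N → ℝ) :
    ∫⁻ U, ENNReal.ofReal (hammingDist (roundBits U x) (roundBits U y)) ∂(roundingLaw N) ≤
      ∑ j, ENNReal.ofReal (|x j - y j| / 2) := by
  have h : ∀ U : Fin N → ℝ, ENNReal.ofReal (hammingDist (roundBits U x) (roundBits U y)) ≤
      ∑ j, (Set.Ioc (min (x j) (y j)) (max (x j) (y j))).indicator 1 (U j) := by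
    intro U
    rw [hammingDist, Finset.card_filter]
    push_cast
    rw [ENNReal.ofReal_sum_of_nonneg fun j _ => by split_ifs <;> simp]
    refine Finset.sum_le_sum fun j _ => ?_
    split_ifs with hj
    · rw [Set.indicator_of_mem]
      · simp
      · by_cases h1 : U j ≤ x j <;> by_cases h2 : U j ≤ y j <;>
          simp_all [roundBits]
    · simp
  have hm : ∀ j : Fin N, Measurable fun U : Fin N → ℝ =>
      (Set.Ioc (min (x j) (y j)) (max (x j) (y j))).indicator (1 : ℝ → ENNReal) (U j) := fun j =>
    (measurable_one.indicator measurableSet_Ioc).comp (measurable_pi_apply j)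
  calc _ ≤ ∫⁻ U, ∑ j, (Set.Ioc (min (x j) (y j)) (max (x j) (y j))).indicator 1 (U j)
        ∂(roundingLaw N) := lintegral_mono h
    _ = ∑ j, ∫⁻ U, (Set.Ioc (min (x j) (y j)) (max (x j) (y j))).indicator 1 (U j)
        ∂(roundingLaw N) := lintegral_finsetSum _ fun j _ => hm j
    _ ≤ _ := by
        refine Finset.sum_le_sum fun j _ => ?_
        have := (measurePreserving_eval
          (fun _ : Fin N => cond (volume : Measure ℝ) (Set.Icc (-1 : ℝ) 1)) j).lintegral_comp
          (f := (Set.Ioc (min (x j) (y j)) (max (x j) (y j))).indicator 1)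
          (measurable_one.indicator measurableSet_Ioc)
        refine (le_of_eq this).trans ?_
        rw [lintegral_indicator_one measurableSet_Ioc]
        exact cond_Icc_le_abs_sub _ _

/-- Both runs share `ω` and `U`. The bound `|u|/2 ≤ τ/4 + u²/(4τ)` passes from the first moment
given by rounding to the second moment controlled by noise stability; `τ` is free. -/
theorem lintegral_hammingDist_le {M N D : ℕ} {Ω : Type*} [MeasurableSpace Ω] {P : Measure Ω}
    [IsProbabilityMeasure P] {A : (Fin M → Fin N → ℝ) → Ω → Fin N → ℝ}
    (hA : Measurable fun z : (Fin M → Fin N → ℝ) × Ω => A z.1 z.2)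
    (hD : IsPolynomialOfDegree D A) {ρ : ℝ} (h0 : 0 ≤ ρ) (h1 : ρ ≤ 1) {τ : ℝ} (hτ : 0 < τ) :
    ∫⁻ w, ∫⁻ p, ENNReal.ofReal (hammingDist (roundBits w.2 (A p.1 w.1))
        (roundBits w.2 (A (ouStep ρ p.1 p.2) w.1))) ∂((disorderLaw M N).prod (disorderLaw M N))
        ∂(P.prod (roundingLaw N)) ≤
      ENNReal.ofReal (N * τ / 4) +
        ENNReal.ofReal ((1 - ρ ^ (D + 1)) / (2 * τ)) * secondMoment P A := by
  set γ := disorderLaw M N with hγ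
  have hp0 : 0 ≤ 1 - ρ ^ (D + 1) := by have := pow_le_one₀ (n := D + 1) h0 h1; linarith
  have hAm : ∀ ω j, Measurable fun G => A G ω j := fun ω j =>
    (measurable_pi_apply j).comp (hA.comp (measurable_id.prodMk measurable_const))
  have hAj : ∀ j, Measurable fun z : (Fin M → Fin N → ℝ) × Ω => A z.1 z.2 j := fun j =>
    (measurable_pi_apply j).comp hA
  have hou : Measurable fun p : (Fin M → Fin N → ℝ) × (Fin M → Fin N → ℝ) =>
    ouStep ρ p.1 p.2 := measurable_ouStep ρ
  have hjoint : Measurable fun z : (Ω × (Fin N → ℝ)) × (Fin M → Fin N → ℝ) =>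
      roundBits z.1.2 (A z.2 z.1.1) :=
    measurable_roundBits.comp ((measurable_snd.comp measurable_fst).prodMk
      (hA.comp (measurable_snd.prodMk (measurable_fst.comp measurable_fst))))
  have hham : Measurable fun z : (Ω × (Fin N → ℝ)) ×
      ((Fin M → Fin N → ℝ) × (Fin M → Fin N → ℝ)) =>
      ENNReal.ofReal (hammingDist (roundBits z.1.2 (A z.2.1 z.1.1))
        (roundBits z.1.2 (A (ouStep ρ z.2.1 z.2.2) z.1.1))) := by
    have := (measurable_hammingDist hjoint).comp
      (f := fun z : (Ω × (Fin N → ℝ)) × ((Fin M → Fin N → ℝ) × (Fin M → Fin N → ℝ)) =>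
        ((z.1, z.2.1), (z.1, ouStep ρ z.2.1 z.2.2)))
      ((measurable_fst.prodMk (measurable_fst.comp measurable_snd)).prodMk
        (measurable_fst.prodMk (hou.comp measurable_snd)))
    exact ENNReal.measurable_ofReal.comp this
  have hsq : ∀ j, Measurable fun z : (Fin M → Fin N → ℝ) × Ω =>
      ENNReal.ofReal (A z.1 z.2 j ^ 2) := fun j =>
    ENNReal.measurable_ofReal.comp ((hAj j).pow_const 2)
  have hpoly : ∀ ω j, ∫⁻ p, ENNReal.ofReal ((A p.1 ω j - A (ouStep ρ p.1 p.2) ω j) ^ 2)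
      ∂(γ.prod γ) ≤ ENNReal.ofReal (2 * (1 - ρ ^ (D + 1))) *
        ∫⁻ G, ENNReal.ofReal (A G ω j ^ 2) ∂γ := by
    intro ω j
    obtain ⟨q, hq, hAq⟩ := hD ω j
    have hmem : (fun G => A G ω j) ∈
        degreeBelow (entry : Fin M × Fin N → (Fin M → Fin N → ℝ) →ₗ[ℝ] ℝ) (D + 1) := by
      have := eval_mem_degreeBelow
        (entry : Fin M × Fin N → (Fin M → Fin N → ℝ) →ₗ[ℝ] ℝ) hq
      convert this using 1
      ext G
      exact hAq G
    exact (rotationInvariant_disorderLaw M N).lintegral_sub_sq_le memLp_entry h0 h1 (D + 1) hmem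
  have hpt : ∀ u : ℝ, ENNReal.ofReal (|u| / 2) ≤
      ENNReal.ofReal (τ / 4) + ENNReal.ofReal (1 / (4 * τ)) * ENNReal.ofReal (u ^ 2) := by
    intro u
    rw [← ENNReal.ofReal_mul (by positivity), ← ENNReal.ofReal_add (by positivity) (by positivity)]
    refine ENNReal.ofReal_le_ofReal ?_
    rw [show τ / 4 + 1 / (4 * τ) * u ^ 2 = (τ ^ 2 + u ^ 2) / (4 * τ) by field_simp,
      div_le_div_iff₀ (by norm_num) (by positivity), ← sq_abs u]
    nlinarith [sq_nonneg (τ - |u|)]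
  have hω : ∀ ω, ∫⁻ U, ∫⁻ p, ENNReal.ofReal (hammingDist (roundBits U (A p.1 ω))
      (roundBits U (A (ouStep ρ p.1 p.2) ω))) ∂(γ.prod γ) ∂(roundingLaw N) ≤ ENNReal.ofReal (N * τ / 4) +
        ENNReal.ofReal ((1 - ρ ^ (D + 1)) / (2 * τ)) *
          ∑ j, ∫⁻ G, ENNReal.ofReal (A G ω j ^ 2) ∂γ := by
    intro ω
    have hm : Measurable fun z : (Fin N → ℝ) × ((Fin M → Fin N → ℝ) × (Fin M → Fin N → ℝ)) =>
        ENNReal.ofReal (hammingDist (roundBits z.1 (A z.2.1 ω))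
          (roundBits z.1 (A (ouStep ρ z.2.1 z.2.2) ω))) :=
      hham.comp (f := fun z : (Fin N → ℝ) × ((Fin M → Fin N → ℝ) × (Fin M → Fin N → ℝ)) =>
        ((ω, z.1), z.2)) ((measurable_const.prodMk measurable_fst).prodMk measurable_snd)
    have hd : ∀ j, Measurable fun p : (Fin M → Fin N → ℝ) × (Fin M → Fin N → ℝ) =>
        ENNReal.ofReal ((A p.1 ω j - A (ouStep ρ p.1 p.2) ω j) ^ 2) := fun j =>
      ENNReal.measurable_ofReal.comp
        ((((hAm ω j).comp measurable_fst).sub ((hAm ω j).comp hou)).pow_const 2)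
    rw [lintegral_lintegral_swap hm.aemeasurable]
    calc _ ≤ ∫⁻ p, ∑ j, (ENNReal.ofReal (τ / 4) + ENNReal.ofReal (1 / (4 * τ)) *
          ENNReal.ofReal ((A p.1 ω j - A (ouStep ρ p.1 p.2) ω j) ^ 2)) ∂(γ.prod γ) :=
          lintegral_mono fun p => (lintegral_hammingDist_roundBits_le _ _).trans
            (Finset.sum_le_sum fun j _ => hpt _)
      _ = ∑ j, (ENNReal.ofReal (τ / 4) + ENNReal.ofReal (1 / (4 * τ)) * ∫⁻ p,
          ENNReal.ofReal ((A p.1 ω j - A (ouStep ρ p.1 p.2) ω j) ^ 2) ∂(γ.prod γ)) := by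
          have hdj : ∀ j, Measurable fun p : (Fin M → Fin N → ℝ) × (Fin M → Fin N → ℝ) =>
              ENNReal.ofReal (τ / 4) + ENNReal.ofReal (1 / (4 * τ)) *
                ENNReal.ofReal ((A p.1 ω j - A (ouStep ρ p.1 p.2) ω j) ^ 2) := fun j =>
            measurable_const.add ((hd j).const_mul _)
          rw [lintegral_finsetSum _ fun j _ => hdj j]
          refine Finset.sum_congr rfl fun j _ => ?_
          rw [lintegral_add_left measurable_const, lintegral_const_mul _ (hd j)]
          simp
      _ ≤ ∑ j, (ENNReal.ofReal (τ / 4) + ENNReal.ofReal (1 / (4 * τ)) *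
          (ENNReal.ofReal (2 * (1 - ρ ^ (D + 1))) * ∫⁻ G, ENNReal.ofReal (A G ω j ^ 2) ∂γ)) := by
          gcongr with j
          exact hpoly ω j
      _ = _ := by
          rw [Finset.sum_add_distrib, ← Finset.mul_sum, ← Finset.mul_sum, ← mul_assoc,
            ← ENNReal.ofReal_mul (by positivity)]
          congr 1
          · simp only [Finset.sum_const, Finset.card_univ, Fintype.card_fin, nsmul_eq_mul]
            rw [← ENNReal.ofReal_natCast, ← ENNReal.ofReal_mul (by positivity)]
            congr 1; ring
          · congr 2; field_simp; norm_num
  rw [lintegral_prod _ (Measurable.lintegral_prod_right' hham).aemeasurable]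
  refine (lintegral_mono hω).trans ?_
  have hmj : ∀ j, Measurable fun ω => ∫⁻ G, ENNReal.ofReal (A G ω j ^ 2) ∂γ := fun j =>
    Measurable.lintegral_prod_left' (hsq j)
  rw [lintegral_add_left measurable_const,
    lintegral_const_mul _ (Finset.measurable_sum _ fun j _ => hmj j)]
  simp only [lintegral_const, measure_univ, mul_one]
  gcongr
  rw [secondMoment, lintegral_finsetSum _ fun j _ => hmj j]
  have e : ∀ z : (Fin M → Fin N → ℝ) × Ω, ENNReal.ofReal (∑ j, A z.1 z.2 j ^ 2) =
      ∑ j, ENNReal.ofReal (A z.1 z.2 j ^ 2) := fun z =>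
    ENNReal.ofReal_sum_of_nonneg fun j _ => sq_nonneg _
  simp_rw [e]
  rw [lintegral_finsetSum _ fun j _ => hsq j]
  refine Finset.sum_le_sum fun j _ => ?_
  rw [lintegral_prod_symm _ (hsq j).aemeasurable]

/-- Both ends of a step are solved with probability at least `p²` on average over `(ω, U)`, by
positivity of the operator and Jensen; the outputs are far apart with probability at most `p²/2`, by
Markov. -/
theorem exists_stable_of_successProb {M N D : ℕ} (hN : 0 < N) {Ω : Type*} [MeasurableSpace Ω]
    {P : Measure Ω} [IsProbabilityMeasure P] {A : (Fin M → Fin N → ℝ) → Ω → Fin N → ℝ}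
    (hA : Measurable fun z : (Fin M → Fin N → ℝ) × Ω => A z.1 z.2)
    (hD : IsPolynomialOfDegree D A) {B : ℝ}
    (hB : secondMoment P A ≤ ENNReal.ofReal (B * N)) {κ p δ ρ : ℝ} (hp : 0 < p) (hδ : 0 < δ)
    (h0 : 0 ≤ ρ) (h1 : ρ < 1) (hρ : 2 * B * (1 - ρ ^ (D + 1)) ≤ δ ^ 2 * p ^ 4)
    (hsucc : ENNReal.ofReal p ≤ successProb P A (Set.Ici κ)) :
    ∃ a : (Fin M → Fin N → ℝ) → Fin N → Bool, Measurable a ∧ ENNReal.ofReal (p ^ 2 / 2) ≤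
      ((disorderLaw M N).prod (disorderLaw M N))
        {q | (q.1, ouStep ρ q.1 q.2) ∈ stablePairs κ (δ * N) a} := by
  set γ := disorderLaw M N with hγ
  set Q := P.prod (roundingLaw N) with hQ
  have hN' : (0 : ℝ) < N := by exact_mod_cast hN
  set a : Ω × (Fin N → ℝ) → (Fin M → Fin N → ℝ) → Fin N → Bool :=
    fun w G => roundBits w.2 (A G w.1) with ha
  have hjoint : Measurable fun z : (Ω × (Fin N → ℝ)) × (Fin M → Fin N → ℝ) => a z.1 z.2 :=
    measurable_roundBits.comp ((measurable_snd.comp measurable_fst).prodMk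
      (hA.comp (measurable_snd.prodMk (measurable_fst.comp measurable_fst))))
  have ham : ∀ w, Measurable (a w) := fun w => hjoint.comp (measurable_const.prodMk measurable_id)
  set S : Ω × (Fin N → ℝ) → Set (Fin M → Fin N → ℝ) :=
    fun w => {G | cubePoint (a w G) ∈ solutions G (Set.Ici κ)} with hS
  have hSm : MeasurableSet {z : (Ω × (Fin N → ℝ)) × (Fin M → Fin N → ℝ) | z.2 ∈ S z.1} := by
    have : {z : (Ω × (Fin N → ℝ)) × (Fin M → Fin N → ℝ) | z.2 ∈ S z.1} =
        ⋂ i, {z | κ ≤ (∑ j, z.2 i j * cubePoint (a z.1 z.2) j) / √N} := by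
      ext z
      simp only [hS, solutions, Set.mem_ofPred_eq, Set.mem_Ici, Set.mem_iInter]
      exact ⟨fun h => h.2, fun h => ⟨cubePoint_mem _, h⟩⟩
    rw [this]
    have hb := measurable_cubePoint hjoint
    exact MeasurableSet.iInter fun i => measurableSet_le measurable_const (by fun_prop)
  have hSw : ∀ w, MeasurableSet (S w) := fun w => measurable_prodMk_left hSm
  have hmu : Measurable fun w => γ (S w) := measurable_measure_prodMk_left hSm
  have e1 : successProb P A (Set.Ici κ) = ∫⁻ w, γ (S w) ∂Q := by
    have hsw := Measure.measurePreserving_swap (μ := γ) (ν := Q)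
    rw [successProb]
    have e2 : {z : (Fin M → Fin N → ℝ) × (Ω × (Fin N → ℝ)) |
        IsingPerceptron.round z.2.2 (A z.1 z.2.1) ∈ solutions z.1 (Set.Ici κ)} =
        Prod.swap ⁻¹' {z : (Ω × (Fin N → ℝ)) × (Fin M → Fin N → ℝ) | z.2 ∈ S z.1} := by
      ext z
      simp only [hS, ha, Set.mem_preimage, Set.mem_ofPred_eq, cubePoint_roundBits, Prod.snd_swap,
        Prod.fst_swap]
    rw [e2, hsw.measure_preimage hSm.nullMeasurableSet, Measure.prod_apply hSm]
    rfl
  have hou : Measurable fun p : (Fin M → Fin N → ℝ) × (Fin M → Fin N → ℝ) =>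
    ouStep ρ p.1 p.2 := measurable_ouStep ρ
  set both : Ω × (Fin N → ℝ) → Set ((Fin M → Fin N → ℝ) × (Fin M → Fin N → ℝ)) :=
    fun w => {q | q.1 ∈ S w ∧ ouStep ρ q.1 q.2 ∈ S w} with hboth
  set far : Ω × (Fin N → ℝ) → Set ((Fin M → Fin N → ℝ) × (Fin M → Fin N → ℝ)) :=
    fun w => {q | δ * N < hammingDist (a w q.1) (a w (ouStep ρ q.1 q.2))} with hfar
  set good : Ω × (Fin N → ℝ) → Set ((Fin M → Fin N → ℝ) × (Fin M → Fin N → ℝ)) :=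
    fun w => {q | (q.1, ouStep ρ q.1 q.2) ∈ stablePairs κ (δ * N) (a w)} with hgood
  have hsplit : ∀ w, (γ.prod γ) (both w) ≤ (γ.prod γ) (good w) + (γ.prod γ) (far w) := by
    intro w
    refine (measure_mono ?_).trans (measure_union_le _ _)
    rintro q ⟨hq1, hq2⟩
    by_cases h : δ * N < hammingDist (a w q.1) (a w (ouStep ρ q.1 q.2))
    · exact Or.inr h
    · exact Or.inl ⟨hq1, hq2, not_lt.mp h⟩
  have hlow : ∀ w, γ (S w) ^ 2 ≤ (γ.prod γ) (both w) := by
    intro w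
    have := (rotationInvariant_disorderLaw M N).sq_lintegral_le_ouStep h0 h1
      (f := (S w).indicator 1) (measurable_one.indicator (hSw w))
    rw [lintegral_indicator_one (hSw w)] at this
    refine this.trans (le_of_eq ?_)
    have hbm : MeasurableSet (both w) := (measurable_fst (hSw w)).inter (hou (hSw w))
    rw [← lintegral_indicator_one hbm, lintegral_prod _
      (measurable_one.indicator hbm).aemeasurable]
    refine lintegral_congr fun x => lintegral_congr fun z => ?_
    by_cases hx : x ∈ S w <;> by_cases hy : ouStep ρ x z ∈ S w <;>
      simp [hboth, hx, hy]
  have hham : Measurable fun z : (Ω × (Fin N → ℝ)) ×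
      ((Fin M → Fin N → ℝ) × (Fin M → Fin N → ℝ)) =>
      (hammingDist (a z.1 z.2.1) (a z.1 (ouStep ρ z.2.1 z.2.2)) : ℝ) :=
    (measurable_hammingDist hjoint).comp
      (f := fun z : (Ω × (Fin N → ℝ)) × ((Fin M → Fin N → ℝ) × (Fin M → Fin N → ℝ)) =>
        ((z.1, z.2.1), (z.1, ouStep ρ z.2.1 z.2.2)))
      ((measurable_fst.prodMk (measurable_fst.comp measurable_snd)).prodMk
        (measurable_fst.prodMk (hou.comp measurable_snd)))
  have hfarm : Measurable fun w => (γ.prod γ) (far w) :=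
    measurable_measure_prodMk_left (measurableSet_lt measurable_const hham)
  have hfarle : ∫⁻ w, (γ.prod γ) (far w) ∂Q ≤ ENNReal.ofReal (p ^ 2 / 2) := by
    -- With `τ = δp²` both terms of the expected distance are at most `Nδp²/4`, and Markov at level
    -- `δN` gives `p²/2`.
    have hτ : 0 < δ * p ^ 2 := by positivity
    have hle := lintegral_hammingDist_le hA hD h0 h1.le hτ (P := P)
    have hmk : ∀ w, ENNReal.ofReal (δ * N) * (γ.prod γ) (far w) ≤ ∫⁻ q, ENNReal.ofReal
        (hammingDist (a w q.1) (a w (ouStep ρ q.1 q.2))) ∂(γ.prod γ) := by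
      intro w
      refine le_trans ?_ (mul_meas_ge_le_lintegral
        (ENNReal.measurable_ofReal.comp (hham.comp measurable_prodMk_left)) (ENNReal.ofReal (δ * N)))
      gcongr
      intro q hq
      exact ENNReal.ofReal_le_ofReal (le_of_lt hq)
    have h2 : ENNReal.ofReal (δ * N) * ∫⁻ w, (γ.prod γ) (far w) ∂Q ≤
        ENNReal.ofReal (δ * N) * ENNReal.ofReal (p ^ 2 / 2) := by
      rw [← lintegral_const_mul _ hfarm, ← ENNReal.ofReal_mul (by positivity)]
      refine (lintegral_mono hmk).trans (hle.trans ?_)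
      have hp0 : 0 ≤ 1 - ρ ^ (D + 1) := by have := pow_le_one₀ (n := D + 1) h0 h1.le; linarith
      calc _ ≤ ENNReal.ofReal (N * (δ * p ^ 2) / 4) +
            ENNReal.ofReal ((1 - ρ ^ (D + 1)) / (2 * (δ * p ^ 2))) * ENNReal.ofReal (B * N) := by
            gcongr
        _ ≤ ENNReal.ofReal (N * (δ * p ^ 2) / 4) + ENNReal.ofReal (N * (δ * p ^ 2) / 4) := by
            rw [← ENNReal.ofReal_mul (by positivity)]
            gcongr
            rw [div_mul_eq_mul_div, div_le_div_iff₀ (by positivity) (by norm_num)]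
            nlinarith
        _ = _ := by
            rw [← ENNReal.ofReal_add (by positivity) (by positivity)]
            congr 1; ring
    exact (ENNReal.mul_le_mul_iff_right (by simpa using by positivity) (by simp)).mp h2
  have hint : ENNReal.ofReal (p ^ 2 / 2) ≤ ∫⁻ w, (γ.prod γ) (good w) ∂Q := by
    have h2 : ENNReal.ofReal (p ^ 2) ≤
        ∫⁻ w, (γ.prod γ) (good w) ∂Q + ENNReal.ofReal (p ^ 2 / 2) := by
      calc ENNReal.ofReal (p ^ 2) = ENNReal.ofReal p ^ 2 := ENNReal.ofReal_pow hp.le 2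
        _ ≤ (∫⁻ w, γ (S w) ∂Q) ^ 2 := by rw [← e1]; gcongr
        _ ≤ ∫⁻ w, γ (S w) ^ 2 ∂Q := sq_lintegral_le hmu
        _ ≤ ∫⁻ w, ((γ.prod γ) (good w) + (γ.prod γ) (far w)) ∂Q :=
            lintegral_mono fun w => (hlow w).trans (hsplit w)
        _ = ∫⁻ w, (γ.prod γ) (good w) ∂Q + ∫⁻ w, (γ.prod γ) (far w) ∂Q :=
            lintegral_add_right _ hfarm
        _ ≤ _ := by gcongr
    have h3 : ENNReal.ofReal (p ^ 2) = ENNReal.ofReal (p ^ 2 / 2) + ENNReal.ofReal (p ^ 2 / 2) := by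
      rw [← ENNReal.ofReal_add (by positivity) (by positivity), add_halves]
    rw [h3] at h2
    exact (ENNReal.add_le_add_iff_right ENNReal.ofReal_ne_top).mp h2
  -- Derandomisation: some value of `(ω, U)` does at least as well as the average.
  obtain ⟨w, hw⟩ := exists_lintegral_le (μ := Q) (f := fun w => (γ.prod γ) (good w)) (by
    refine ne_top_of_le_ne_top ENNReal.one_ne_top ?_
    calc _ ≤ ∫⁻ w, 1 ∂Q := lintegral_mono fun w => prob_le_one
      _ = 1 := by simp)
  exact ⟨a w, ham w, hint.trans hw⟩

/-! ### Comparison of the two bounds and the limit -/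

/-- The Jensen argument by doubling needs a path length that is a power of two. -/
theorem exists_pow_two_between (x : ℕ) : ∃ k : ℕ, x ≤ 2 ^ k ∧ 2 ^ k ≤ 2 * (x + 1) := by
  induction x with
  | zero => exact ⟨0, by simp, by simp⟩
  | succ x ih =>
    obtain ⟨k, h1, h2⟩ := ih
    rcases Nat.lt_or_ge x (2 ^ k) with h | h
    · exact ⟨k, h, by omega⟩
    · exact ⟨k + 1, by rw [pow_succ]; have := Nat.one_le_two_pow (n := k); omega,
        by rw [pow_succ]; omega⟩

/-- The quantitative obstruction at a fixed dimension, in logarithmic form. -/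
theorem le_of_successProb {M N D : ℕ} (hN : 0 < N) {Ω : Type*} [MeasurableSpace Ω]
    {P : Measure Ω} [IsProbabilityMeasure P] {A : (Fin M → Fin N → ℝ) → Ω → Fin N → ℝ}
    (hA : Measurable fun z : (Fin M → Fin N → ℝ) × Ω => A z.1 z.2)
    (hD : IsPolynomialOfDegree D A) {B : ℝ} (hB1 : 1 ≤ B)
    (hB : secondMoment P A ≤ ENNReal.ofReal (B * N)) {κ p δ l : ℝ} (hκ : κ ≤ 0) (hp : 0 < p)
    (hp1 : p ≤ 1) (hδ : 0 < δ) (hδ1 : 4 * δ ≤ 1) (hl : 0 ≤ l) {n : ℕ}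
    (hn : n * Real.exp (-(κ ^ 2 * (1 + δ) / 2)) ≤ (gaussianReal 0 1).real (Set.Iio κ))
    (hsucc : ENNReal.ofReal p ≤ successProb P A (Set.Ici κ)) :
    M * ((n + 1) * (gaussianReal 0 1).real (Set.Iio κ) / 2) ≤
      N * (Real.log 2 + n * (2 * δ * l + Real.exp (-l))) + n * Real.log (n + 1) +
        (n + 1 + Real.log (2 / p ^ 2)) *
          ((2 * n / (δ ^ 2 * p ^ 4 / (2 * B)) + 2 * n + 2) * (D + 1)) := by
  -- Chosen so that, with `ε = θ/(D+1)`, Bernoulli's inequality gives `1 - (1-ε)^(D+1) ≤ θ`, which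
  -- is the stability requirement.
  set θ := δ ^ 2 * p ^ 4 / (2 * B) with hθ
  have hθ0 : 0 < θ := by positivity
  have hp4 : p ^ 4 ≤ 1 := pow_le_one₀ hp.le hp1
  have hθ1 : θ < 1 := by
    rw [hθ, div_lt_one (by positivity)]
    have : δ ^ 2 ≤ 1 := by nlinarith
    have : δ ^ 2 * p ^ 4 ≤ 1 := mul_le_one₀ this (by positivity) hp4
    linarith
  set d : ℝ := D + 1 with hd
  have hd1 : 1 ≤ d := by rw [hd]; have : (0 : ℝ) ≤ D := by positivity
                         linarith
  set ε := θ / d with hε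
  have hε0 : 0 < ε := by positivity
  have hε1 : ε < 1 := by rw [hε, div_lt_one (by linarith)]; linarith
  have hρ : 2 * B * (1 - (1 - ε) ^ (D + 1)) ≤ δ ^ 2 * p ^ 4 := by
    have h := one_add_mul_le_pow (a := -ε) (by linarith) (D + 1)
    have e : ((D + 1 : ℕ) : ℝ) * -ε = -θ := by
      rw [hε, hd]; push_cast; field_simp
    rw [e, ← sub_eq_add_neg, ← sub_eq_add_neg] at h
    calc 2 * B * (1 - (1 - ε) ^ (D + 1)) ≤ 2 * B * θ := by
          gcongr; linarith
      _ = _ := by rw [hθ]; field_simp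
  obtain ⟨a, ham, hpair⟩ := exists_stable_of_successProb hN hA hD hB hp hδ (ρ := 1 - ε)
    (by linarith) (by linarith) hρ hsucc
  -- After `1/ε` steps the correlation is at most `exp(-1) ≤ 1/2 ≤ 1 - 2δ`.
  set g := ⌈1 / ε⌉₊ with hg
  have hg1 : (1 - ε) ^ g ≤ 1 - 2 * δ := by
    have h1 : 1 - ε ≤ Real.exp (-ε) := by have := Real.add_one_le_exp (-ε); linarith
    calc (1 - ε) ^ g ≤ Real.exp (-ε) ^ g := pow_le_pow_left₀ (by linarith) h1 g
      _ = Real.exp (-(g * ε)) := by rw [← Real.exp_nat_mul]; ring_nf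
      _ ≤ Real.exp (-1) := by
          refine Real.exp_le_exp.mpr (neg_le_neg ?_)
          rw [← div_le_iff₀ hε0]; exact Nat.le_ceil _
      _ ≤ 1 / 2 := by
          rw [Real.exp_neg, inv_eq_one_div]
          have := Real.add_one_le_exp 1
          gcongr; linarith
      _ ≤ _ := by linarith
  obtain ⟨k, hk1, hk2⟩ := exists_pow_two_between (n * g)
  have key := prob_stablePairs_pow_le (M := M) hN (ρ := 1 - ε) (by linarith) (by linarith) hκ hδ
    (by linarith) hl hg1 hk1 hn ham
  set T := 2 ^ k with hT
  set q := (gaussianReal 0 1).real (Set.Iio κ) with hq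
  have key2 : ENNReal.ofReal ((p ^ 2 / 2) ^ T) ≤ _ :=
    (ENNReal.ofReal_pow (by positivity) _).trans_le ((pow_le_pow_left₀ zero_le hpair T).trans key)
  rw [ENNReal.ofReal_le_ofReal_iff (by positivity)] at key2
  have hlog := Real.log_le_log (by positivity) key2
  rw [Real.log_pow, Real.log_mul (by positivity) (by positivity), Real.log_exp,
    Real.log_mul (by positivity) (by positivity), Real.log_mul (by positivity) (by positivity),
    Real.log_pow, Real.log_pow, Real.log_pow, Real.log_mul (by positivity) (by positivity),
    Real.log_exp] at hlog
  -- This crude bound on the entropy of the times suffices: for fixed `n`, `p`, `δ`, `B` it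
  -- contributes `O(T) = O(D + 1)`.
  have hT1 : Real.log ((T : ℝ) + 1) ≤ T := by
    have := Real.log_le_sub_one_of_pos (show (0 : ℝ) < (T : ℝ) + 1 by positivity)
    linarith
  have hinv : Real.log (p ^ 2 / 2) = -Real.log (2 / p ^ 2) := by rw [← Real.log_inv, inv_div]
  have hΛ : 0 ≤ Real.log (2 / p ^ 2) := by
    refine Real.log_nonneg ?_
    rw [le_div_iff₀ (by positivity)]
    nlinarith
  have hTd : (T : ℝ) ≤ (2 * n / θ + 2 * n + 2) * d := by
    have h1 : (g : ℝ) ≤ 1 / ε + 1 := (Nat.ceil_lt_add_one (by positivity)).le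
    have h2 : (T : ℝ) ≤ 2 * (n * g + 1) := by exact_mod_cast hk2
    have h3 : 1 / ε = d / θ := by rw [hε, one_div_div]
    rw [h3] at h1
    have hn0 : (0 : ℝ) ≤ n := by positivity
    calc (T : ℝ) ≤ 2 * (n * (d / θ + 1) + 1) := h2.trans (by gcongr)
      _ = 2 * n / θ * d + (2 * n + 2) * 1 := by ring
      _ ≤ 2 * n / θ * d + (2 * n + 2) * d := by gcongr
      _ = _ := by ring
  rw [hinv] at hlog
  push_cast at hlog
  have hn0 : (0 : ℝ) ≤ n := by positivity
  have h5 : ((n : ℝ) + 1) * Real.log (T + 1) ≤ (n + 1) * T := by gcongr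
  have h6 : ((n : ℝ) + 1 + Real.log (2 / p ^ 2)) * T ≤
      (n + 1 + Real.log (2 / p ^ 2)) * ((2 * n / θ + 2 * n + 2) * d) := by gcongr
  linarith

theorem tendsto_degree_div {D : ℕ → ℕ}
    (hD : (fun N => (D N : ℝ)) =o[atTop] (fun N : ℕ => (N : ℝ) / Real.log N)) :
    Tendsto (fun N : ℕ => (D N : ℝ) / N) atTop (𝓝 0) := by
  refine IsLittleO.tendsto_div_nhds_zero (hD.trans_isBigO ?_)
  refine IsBigO.of_bound 1 ?_
  filter_upwards [eventually_ge_atTop 3] with N hN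
  have hN' : (3 : ℝ) ≤ N := by exact_mod_cast hN
  have hlog : 1 ≤ Real.log N := by
    rw [Real.le_log_iff_exp_le (by linarith)]
    linarith [Real.exp_one_lt_d9]
  rw [one_mul, norm_div, Real.norm_of_nonneg (by linarith : (0 : ℝ) ≤ Real.log N)]
  exact div_le_self (norm_nonneg _) hlog

/-- Low degree algorithms fail below any first moment bound on clusters of `n + 1` solutions. -/
theorem tendsto_successProb_zero {κ α δ l : ℝ} (hκ : κ ≤ 0) (hδ : 0 < δ) (hδ1 : 4 * δ ≤ 1)
    (hl : 0 ≤ l) {n : ℕ}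
    (hn : n * Real.exp (-(κ ^ 2 * (1 + δ) / 2)) ≤ (gaussianReal 0 1).real (Set.Iio κ))
    (hgap : Real.log 2 + n * (2 * δ * l + Real.exp (-l)) <
      α * ((n + 1) * (gaussianReal 0 1).real (Set.Iio κ) / 2))
    {M : ℕ → ℕ} (hM : Tendsto (fun N => (M N : ℝ) / N) atTop (𝓝 α)) {D : ℕ → ℕ}
    (hD : (fun N => (D N : ℝ)) =o[atTop] (fun N : ℕ => (N : ℝ) / Real.log N))
    {Ω : ℕ → Type*} [∀ N, MeasurableSpace (Ω N)] {P : ∀ N, Measure (Ω N)}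
    [∀ N, IsProbabilityMeasure (P N)] {A : ∀ N, (Fin (M N) → Fin N → ℝ) → Ω N → Fin N → ℝ}
    (hA : ∀ N, Measurable fun z : (Fin (M N) → Fin N → ℝ) × Ω N => A N z.1 z.2)
    (hpoly : ∀ N, IsPolynomialOfDegree (D N) (A N))
    (hB : ∃ B : ℝ, ∀ᶠ N : ℕ in atTop, secondMoment (P N) (A N) ≤ ENNReal.ofReal (B * N)) :
    Tendsto (fun N => successProb (P N) (A N) (Set.Ici κ)) atTop (𝓝 0) := by
  rw [ENNReal.tendsto_nhds_zero]
  intro e he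
  obtain ⟨p, hp0, hp1, hpe⟩ : ∃ p : ℝ, 0 < p ∧ p ≤ 1 ∧ ENNReal.ofReal p ≤ e := by
    refine ⟨(min e 1).toReal, ENNReal.toReal_pos (by simp [he.ne']) (by simp), ?_, ?_⟩
    · exact ENNReal.toReal_le_of_le_ofReal zero_le_one (by simp)
    · rw [ENNReal.ofReal_toReal (by simp)]; exact min_le_left _ _
  obtain ⟨B, hB⟩ := hB
  set q := (gaussianReal 0 1).real (Set.Iio κ) with hq
  set B' := max B 1 with hB'
  set c := ((n : ℝ) + 1 + Real.log (2 / p ^ 2)) *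
    (2 * n / (δ ^ 2 * p ^ 4 / (2 * B')) + 2 * n + 2) with hc
  -- The inequality of `le_of_successProb` divided by `N`: its error terms are `O(1/N)` and
  -- `O(D/N)`, so the strict gap `hgap` survives in the limit.
  have hlim : Tendsto (fun N : ℕ => (M N : ℝ) / N * ((n + 1) * q / 2) -
      (n * Real.log (n + 1) + c) / N - c * ((D N : ℝ) / N)) atTop
      (𝓝 (α * ((n + 1) * q / 2) - 0 - c * 0)) :=
    ((hM.mul_const _).sub (tendsto_const_div_atTop_nhds_zero_nat _)).sub
      ((tendsto_degree_div hD).const_mul c)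
  rw [mul_zero, sub_zero, sub_zero] at hlim
  filter_upwards [hlim.eventually (lt_mem_nhds hgap), hB, eventually_gt_atTop 0] with N h1 h2 hN
  by_contra hcon
  have hN' : (0 : ℝ) < N := by exact_mod_cast hN
  have h3 := le_of_successProb hN (hA N) (hpoly N) (le_max_right B 1)
    (h2.trans (ENNReal.ofReal_le_ofReal (by gcongr; exact le_max_left _ _))) hκ hp0 hp1 hδ hδ1 hl hn
    (hpe.trans (not_le.mp hcon).le)
  rw [← hB', ← mul_assoc, ← hc, ← hq] at h3
  have h4 : ((M N : ℝ) / N * ((n + 1) * q / 2) -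
      (n * Real.log (n + 1) + c) / N - c * ((D N : ℝ) / N)) * N =
      M N * ((n + 1) * q / 2) - (n * Real.log (n + 1) + c) - c * D N := by
    field_simp
  have h5 := mul_lt_mul_of_pos_right h1 hN'
  rw [h4] at h5
  linarith

/-! ### Gaussian tail and choice of parameters -/

/-- A Gaussian lower tail bound. -/
theorem le_gaussianReal_Iio {κ : ℝ} (hκ : κ ≤ -1) :
    Real.exp (-(κ ^ 2 / 2)) / (20 * -κ) ≤ (gaussianReal 0 1).real (Set.Iio κ) := by
  set K := -κ with hK
  have hK1 : 1 ≤ K := by linarith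
  -- The density is integrated over an interval of length `1/K` below `κ`, where its exponent loses
  -- at most `2`; the constant is `√(2π) e² ≤ 2.6 · 7.6 < 20`.
  have hc : Real.exp (-(κ ^ 2 / 2)) / 20 ≤ (√(2 * Real.pi))⁻¹ * Real.exp (-((K + 1 / K) ^ 2 / 2)) := by
    have h1 : -(κ ^ 2 / 2) - 2 ≤ -((K + 1 / K) ^ 2 / 2) := by
      have h2 : (K + 1 / K) ^ 2 = κ ^ 2 + 2 + (1 / K) ^ 2 := by
        rw [show κ = -K by rw [hK]; ring]; field_simp; ring
      have h3 : 1 / K ≤ 1 := by rw [div_le_one (by linarith)]; exact hK1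
      have h4 : 0 ≤ 1 / K := by positivity
      nlinarith
    have h5 : √(2 * Real.pi) ≤ 2.6 := by
      rw [Real.sqrt_le_left (by norm_num)]
      linarith [Real.pi_lt_d2]
    have h6 : Real.exp 2 ≤ 7.6 := by
      have := Real.exp_one_lt_d9
      have h7 : Real.exp 2 = Real.exp 1 ^ 2 := by rw [← Real.exp_nat_mul]; norm_num
      rw [h7]
      nlinarith [Real.exp_pos 1]
    have h8 : 0 < √(2 * Real.pi) := by positivity
    calc Real.exp (-(κ ^ 2 / 2)) / 20 ≤ (√(2 * Real.pi))⁻¹ * Real.exp (-(κ ^ 2 / 2) - 2) := by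
          rw [Real.exp_sub, inv_mul_eq_div, div_div]
          gcongr
          nlinarith [Real.exp_pos 2]
      _ ≤ _ := by gcongr
  have hle : ENNReal.ofReal (Real.exp (-(κ ^ 2 / 2)) / (20 * K)) ≤
      gaussianReal 0 1 (Set.Iio κ) := by
    rw [gaussianReal_apply 0 one_ne_zero]
    calc ENNReal.ofReal (Real.exp (-(κ ^ 2 / 2)) / (20 * K))
        = ENNReal.ofReal (Real.exp (-(κ ^ 2 / 2)) / 20) * volume (Set.Ioo (κ - 1 / K) κ) := by
          rw [Real.volume_Ioo, ← ENNReal.ofReal_mul (by positivity)]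
          congr 1; field_simp; ring
      _ = ∫⁻ _ in Set.Ioo (κ - 1 / K) κ, ENNReal.ofReal (Real.exp (-(κ ^ 2 / 2)) / 20) := by
          rw [setLIntegral_const]
      _ ≤ ∫⁻ x in Set.Ioo (κ - 1 / K) κ, gaussianPDF 0 1 x := by
          refine setLIntegral_mono (measurable_gaussianPDF 0 1) fun x hx => ?_
          refine ENNReal.ofReal_le_ofReal (hc.trans ?_)
          rw [gaussianPDFReal]
          simp only [NNReal.coe_one, mul_one, sub_zero]
          gcongr
          rw [neg_div]
          refine neg_le_neg ?_
          have h1 := hx.1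
          have h2 := hx.2
          gcongr ?_ / 2
          rw [← neg_sq x]
          exact pow_le_pow_left₀ (by linarith) (by linarith) 2
      _ ≤ _ := lintegral_mono_set fun x hx => hx.2
  rw [measureReal_def]
  exact (ENNReal.ofReal_le_iff_le_toReal (measure_ne_top _ _)).mp hle

/-- The cluster size, separation and entropy parameters at which the first moment bound applies. -/
theorem exists_cluster_parameters {κ α : ℝ} (hκ : κ ≤ -1)
    (hα : 4000 * Real.exp (κ ^ 2 / 2) * max 1 (Real.log |κ| ^ 2) / |κ| ≤ α) :
    ∃ (n : ℕ) (δ l : ℝ), 0 < δ ∧ 4 * δ ≤ 1 ∧ 0 ≤ l ∧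
      n * Real.exp (-(κ ^ 2 * (1 + δ) / 2)) ≤ (gaussianReal 0 1).real (Set.Iio κ) ∧
      Real.log 2 + n * (2 * δ * l + Real.exp (-l)) <
        α * ((n + 1) * (gaussianReal 0 1).real (Set.Iio κ) / 2) := by
  have hq := le_gaussianReal_Iio hκ
  set q := (gaussianReal 0 1).real (Set.Iio κ) with hqdef
  obtain ⟨K, hK⟩ : ∃ K, K = -κ := ⟨_, rfl⟩
  have hκK : κ = -K := by rw [hK]; ring
  have hK1 : 1 ≤ K := by linarith
  have hK0 : 0 < K := by linarith
  have habs : |κ| = K := by rw [hκK, abs_neg, abs_of_pos hK0]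
  have hlog0 : 0 ≤ Real.log K := Real.log_nonneg hK1
  set b := max 1 (Real.log K) with hb
  have hb1 : 1 ≤ b := le_max_left _ _
  have hbK : Real.log K ≤ b := le_max_right _ _
  have hmax : max 1 (Real.log |κ| ^ 2) = b ^ 2 := by
    rw [habs, hb]
    rcases le_total 1 (Real.log K) with h | h
    · rw [max_eq_right h, max_eq_right (by nlinarith)]
    · rw [max_eq_left h, max_eq_left (by nlinarith)]; norm_num
  rw [hmax, habs] at hα
  rw [← hK] at hq
  have hκ2 : κ ^ 2 = K ^ 2 := by rw [hκK]; ring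
  rw [hκ2] at hα hq ⊢
  have hα0 : 0 < α := lt_of_lt_of_le (by positivity) hα
  -- `200 = 4000/20`, with `20` from the Gaussian tail bound.
  have hαq : 200 * b ^ 2 / K ^ 2 ≤ α * q := by
    calc 200 * b ^ 2 / K ^ 2 = (4000 * Real.exp (K ^ 2 / 2) * b ^ 2 / K) *
          (Real.exp (-(K ^ 2 / 2)) / (20 * K)) := by
          rw [Real.exp_neg]; field_simp; norm_num
      _ ≤ α * q := mul_le_mul hα hq (by positivity) hα0.le
  have hlog2 : Real.log 2 < 1 := by linarith [Real.log_two_lt_d9]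
  rcases le_or_gt (80 * b) (K ^ 2) with h | h
  -- The gain `exp(-κ²δ/2) = exp(-10b)` from separation beats `1/(20K³)`, which allows `n` up to
  -- `K²`; the case assumption is exactly `4δ ≤ 1`; and `l` makes `exp(-l) = 1/K²`.
  · refine ⟨⌊K ^ 2⌋₊, 20 * b / K ^ 2, 2 * Real.log K, by positivity, ?_, by positivity, ?_, ?_⟩
    · rw [← mul_div_assoc, div_le_one (by positivity)]; linarith
    · refine le_trans ?_ hq
      have h1 : (⌊K ^ 2⌋₊ : ℝ) ≤ K ^ 2 := Nat.floor_le (by positivity)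
      have h2 : -(K ^ 2 * (1 + 20 * b / K ^ 2) / 2) = -(K ^ 2 / 2) - 10 * b := by
        field_simp; ring
      rw [h2, Real.exp_sub]
      have h3 : 20 * K ^ 3 ≤ Real.exp (10 * b) := by
        have h4 : K ≤ Real.exp b := by
          rw [← Real.log_le_iff_le_exp hK0]; exact hbK
        have h5 : 2 ≤ Real.exp b := by have := Real.add_one_le_exp b; linarith
        have h6 : Real.exp (10 * b) = Real.exp b ^ 7 * Real.exp b ^ 3 := by
          rw [← pow_add, ← Real.exp_nat_mul]; norm_num
        have h7 : (2 : ℝ) ^ 7 ≤ Real.exp b ^ 7 := pow_le_pow_left₀ (by norm_num) h5 7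
        have h8 : K ^ 3 ≤ Real.exp b ^ 3 := pow_le_pow_left₀ hK0.le h4 3
        rw [h6]
        exact mul_le_mul (by linarith) h8 (by positivity) (by positivity)
      calc (⌊K ^ 2⌋₊ : ℝ) * (Real.exp (-(K ^ 2 / 2)) / Real.exp (10 * b))
          ≤ K ^ 2 * (Real.exp (-(K ^ 2 / 2)) / Real.exp (10 * b)) := by gcongr
        _ ≤ K ^ 2 * (Real.exp (-(K ^ 2 / 2)) / (20 * K ^ 3)) := by gcongr
        _ = _ := by field_simp
    · have h1 : K ^ 2 < (⌊K ^ 2⌋₊ : ℝ) + 1 := Nat.lt_floor_add_one _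
      have e1 : Real.exp (-(2 * Real.log K)) = 1 / K ^ 2 := by
        rw [Real.exp_neg, two_mul, Real.exp_add, Real.exp_log hK0]; field_simp
      -- `80 b log K + 1 ≤ 81 b²`. With one more `b²/K²` per point to pay for `log 2`, the total
      -- `82` stays below `200/2`.
      have h2 : 2 * (20 * b / K ^ 2) * (2 * Real.log K) + Real.exp (-(2 * Real.log K)) ≤
          81 * b ^ 2 / K ^ 2 := by
        rw [e1]
        calc _ = (80 * (b * Real.log K) + 1) / K ^ 2 := by ring
          _ ≤ _ := by gcongr; nlinarith
      have h3 : 1 ≤ ((⌊K ^ 2⌋₊ : ℝ) + 1) * (b ^ 2 / K ^ 2) := by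
        rw [mul_div_assoc', le_div_iff₀ (by positivity), one_mul]
        have : 1 ≤ b ^ 2 := one_le_pow₀ hb1
        nlinarith
      have h4 : (0 : ℝ) ≤ ⌊K ^ 2⌋₊ := by positivity
      calc _ < ((⌊K ^ 2⌋₊ : ℝ) + 1) * (b ^ 2 / K ^ 2) + ⌊K ^ 2⌋₊ * (81 * b ^ 2 / K ^ 2) := by
            have := mul_le_mul_of_nonneg_left h2 h4
            linarith
        _ ≤ ((⌊K ^ 2⌋₊ : ℝ) + 1) * (b ^ 2 / K ^ 2) +
            (⌊K ^ 2⌋₊ + 1) * (81 * b ^ 2 / K ^ 2) := by gcongr; linarith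
        _ ≤ ((⌊K ^ 2⌋₊ : ℝ) + 1) * (200 * b ^ 2 / K ^ 2) / 2 := by
            have : 0 ≤ ((⌊K ^ 2⌋₊ : ℝ) + 1) * (b ^ 2 / K ^ 2) := by positivity
            have e : ((⌊K ^ 2⌋₊ : ℝ) + 1) * (200 * b ^ 2 / K ^ 2) / 2 =
              100 * (((⌊K ^ 2⌋₊ : ℝ) + 1) * (b ^ 2 / K ^ 2)) := by ring
            have e' : ((⌊K ^ 2⌋₊ : ℝ) + 1) * (81 * b ^ 2 / K ^ 2) =
              81 * (((⌊K ^ 2⌋₊ : ℝ) + 1) * (b ^ 2 / K ^ 2)) := by ring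
            linarith
        _ ≤ ((⌊K ^ 2⌋₊ : ℝ) + 1) * (α * q) / 2 := by gcongr
        _ = _ := by ring
  -- For bounded `K` the plain first moment over single solutions suffices: `K² < 80b ≤ 80b²` gives
  -- `αq/2 ≥ 1 > log 2`.
  · refine ⟨0, 1 / 4, 0, by norm_num, by norm_num, le_rfl, ?_, ?_⟩
    · simp only [Nat.cast_zero, zero_mul]
      exact measureReal_nonneg
    · have h1 : 2 ≤ 200 * b ^ 2 / K ^ 2 := by
        rw [le_div_iff₀ (by positivity)]
        nlinarith
      simp only [Nat.cast_zero, zero_mul, add_zero, zero_add, one_mul]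
      linarith

end IsingPerceptron

end

theorem corollary3p9 :
    ∃ C : ℝ, 0 < C ∧ ∀ κ α : ℝ, κ ≤ -1 →
      C * Real.exp (κ ^ 2 / 2) * max 1 (Real.log |κ| ^ 2) / |κ| ≤ α →
      ∀ M : ℕ → ℕ, Tendsto (fun N => (M N : ℝ) / N) atTop (𝓝 α) →
      ∀ D : ℕ → ℕ, (fun N => (D N : ℝ)) =o[atTop] (fun N : ℕ => (N : ℝ) / Real.log N) →
      ∀ (Ω : ℕ → Type*) [∀ N, MeasurableSpace (Ω N)] (P : ∀ N, Measure (Ω N))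
        [∀ N, IsProbabilityMeasure (P N)]
        (A : ∀ N, (Fin (M N) → Fin N → ℝ) → Ω N → Fin N → ℝ),
        (∀ N, Measurable fun z : (Fin (M N) → Fin N → ℝ) × Ω N => A N z.1 z.2) →
        (∀ N, IsingPerceptron.IsPolynomialOfDegree (D N) (A N)) →
        (∃ B : ℝ, ∀ᶠ N : ℕ in atTop,
          IsingPerceptron.secondMoment (P N) (A N) ≤ ENNReal.ofReal (B * N)) →
        Tendsto (fun N => IsingPerceptron.successProb (P N) (A N) (Set.Ici κ)) atTop (𝓝 0) := by
  refine ⟨4000, by norm_num, fun κ α hκ hα M hM D hD Ω _ P _ A hA hpoly hB => ?_⟩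
  obtain ⟨n, δ, l, hδ, hδ1, hl, hn, hgap⟩ :=
    IsingPerceptron.exists_cluster_parameters hκ hα
  exact IsingPerceptron.tendsto_successProb_zero (by linarith) hδ hδ1 hl hn hgap hM hD hA hpoly hB
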